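/- Let $G$ be a group with a finite generating set $S\subseteq G$, and let $\psi\colon G\to\mathbb{C}$ be a character, i.e. a function of positive type that is constant on conjugacy classes and satisfies $\psi(1)=1$. Let $\ell^\psi(G)$ be the Hilbert space completion of $\mathbb{C}[G]$ with respect to the semi-definite inner product with $\langle g,h\rangle_\psi=\psi(h^{-1}g)$ for $g,h\in G$; it is a Hilbert $G$-bimodule. For a finite set $I$ and a closed left $G$-invariant subspace $V\subseteq \ell^\psi(G)^I$ put $\dim_\psi V=\sum_{i\in I}\langle P_Ve_i,e_i\rangle_\psi$, where $P_V$ is the orthogonal projection onto $V$ and $e_i$ is the $i$-th standard basis vector. For $k\ge 0$, the $k$-th $\psi$-Betti number is $b_k^\psi(G)=\dim_\psi\bigl(\ker \partial_k/\overline{\operatorname{im}\partial_{k+1}}\bigr)$ (with $\partial_0=0$), computed in the complex $\ell^\psi(G)\otimes_{\mathbb{C}[G]}P_*$ for any resolution $P_*$ of the trivial left module $\mathbb{C}$ by free left $\mathbb{C}[G]$-modules such that $P_0,\dots,P_k$ are finitely generated. Let $E=\{(g,gs)\mid g\in G,\ s\in S\}$ be the set of edges of the Cayley graph $\mathrm{Cay}(G,S)$,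 write $\bar s=(1,s)$ for $s\in S$, and let $\partial\colon\mathbb{C}[E]\to\mathbb{C}[G]$, $(g,h)\mapsto h-g$, be the boundary map. Let $Z_{G,S}=\ker\partial$ be the space of finite cycles. Equip $\mathbb{C}[E]$ with the semi-definite inner product such that $\langle (g,gs),(h,ht)\rangle_\psi$ equals $\psi(h^{-1}g)$ if $s=t$ and $0$ if $s\ne t$. Then $b_0^\psi(G)$ and $b_1^\psi(G)$ are well defined (resolutions as above exist and the values do not depend on the resolution), and \[ b_1^\psi(G)=|S|-1+b_0^\psi(G)-\sum_{s\in S}\ \sup_{z}\ \frac{|\langle z,\bar s\rangle_\psi|^2}{\langle z,z\rangle_\psi}, \] where each supremum is taken over all finite cycles $z\in Z_{G,S}$ with $\langle z,z\rangle_\psi\neq 0$, and is defined to be $0$ if there is no such cycle. -/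

import Mathlib

open scoped ComplexOrder

noncomputable section

namespace PsiBetti

universe u

/-! ## Characters and the tracial Hilbert bimodule -/

/-- A character of a group `G`: a class function `ψ : G → ℂ` of positive type with `ψ 1 = 1`.
Positive type means that `∑ g h, conj (x g) * ψ (g⁻¹ * h) * x h` is a nonnegative real number for
every finitely supported `x : G → ℂ` (so that `ψ` is Hermitian). -/
structure GroupCharacter (G : Type u) [Group G] where
  toFun : G → ℂ
  map_one : toFun 1 = 1
  map_conj : ∀ g h : G, toFun (h * g * h⁻¹) = toFun g
  posType : (Matrix.of fun g h : G => toFun (g⁻¹ * h)).PosSemidef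

variable {G : Type u} [Group G]

instance : CoeFun (GroupCharacter G) (fun _ => G → ℂ) := ⟨GroupCharacter.toFun⟩

/-- The sesquilinear form `∑ g h, conj (x g) * ψ (g⁻¹ * h) * y h` on `ℂ[G]`. -/
def charForm (ψ : GroupCharacter G) (x y : G →₀ ℂ) : ℂ :=
  x.sum fun g a => y.sum fun h b => star a * ψ (g⁻¹ * h) * b

lemma charForm_conj_symm (ψ : GroupCharacter G) (x y : G →₀ ℂ) :
    starRingEnd ℂ (charForm ψ y x) = charForm ψ x y := by
  have herm : ∀ g h : G, star (ψ (h⁻¹ * g)) = ψ (g⁻¹ * h) := fun g h =>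
    ψ.posType.1.apply g h
  simp only [charForm, Finsupp.sum, map_sum, map_mul]
  rw [Finset.sum_comm]
  refine Finset.sum_congr rfl fun g _ => Finset.sum_congr rfl fun h _ => ?_
  rw [← herm g h]
  simp only [starRingEnd_apply, star_star]
  ring

lemma charForm_add_left (ψ : GroupCharacter G) (x y z : G →₀ ℂ) :
    charForm ψ (x + y) z = charForm ψ x z + charForm ψ y z := by
  refine Finsupp.sum_add_index' ?_ ?_
  · intro g; simp
  · intro g a b
    rw [← Finsupp.sum_add]
    refine Finsupp.sum_congr fun h _ => ?_
    rw [star_add]; ring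

lemma charForm_smul_left (ψ : GroupCharacter G) (x y : G →₀ ℂ) (r : ℂ) :
    charForm ψ (r • x) y = starRingEnd ℂ r * charForm ψ x y := by
  refine (Finsupp.sum_smul_index ?_).trans ?_
  · intro g; simp
  · rw [charForm, Finsupp.mul_sum]
    refine Finsupp.sum_congr fun g _ => ?_
    rw [Finsupp.mul_sum]
    refine Finsupp.sum_congr fun h _ => ?_
    rw [star_mul, starRingEnd_apply]; ring

lemma charForm_translate (ψ : GroupCharacter G) (g : G) (x y : G →₀ ℂ) :
    charForm ψ (x.mapDomain fun h => h * g) (y.mapDomain fun h => h * g) = charForm ψ x y := by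
  have hinj : Function.Injective (fun h : G => h * g) := mul_left_injective g
  unfold charForm
  rw [Finsupp.sum_mapDomain_index_inj hinj]
  refine Finsupp.sum_congr fun k _ => ?_
  rw [Finsupp.sum_mapDomain_index_inj hinj]
  refine Finsupp.sum_congr fun l _ => ?_
  have h := ψ.map_conj (k⁻¹ * l) g⁻¹
  have e : g⁻¹ * (k⁻¹ * l) * g⁻¹⁻¹ = (k * g)⁻¹ * (l * g) := by group
  rw [e] at h
  rw [h]

/-- The underlying vector space of the group ring `ℂ[G]`, as a type synonym that carries the
semi-definite inner product given by `ψ`. -/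
@[nolint unusedArguments]
def PreEll (_ψ : GroupCharacter G) : Type u := G →₀ ℂ

instance (ψ : GroupCharacter G) : AddCommGroup (PreEll ψ) := inferInstanceAs (AddCommGroup (G →₀ ℂ))
instance (ψ : GroupCharacter G) : Module ℂ (PreEll ψ) := inferInstanceAs (Module ℂ (G →₀ ℂ))

/-- The identity map, from `ℂ[G]` to its synonym. -/
def PreEll.of (ψ : GroupCharacter G) : (G →₀ ℂ) ≃ₗ[ℂ] PreEll ψ := LinearEquiv.refl ℂ _

/-- The semi-definite inner product `⟨h, g⟩_ψ = ψ (g⁻¹ * h)`. Mathlib's inner products are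
conjugate-linear in the first variable, so `inner ℂ x y` is `⟨y, x⟩_ψ` in the convention where
`⟨·, ·⟩_ψ` is linear in the first variable. -/
abbrev preCore (ψ : GroupCharacter G) : PreInnerProductSpace.Core ℂ (PreEll ψ) where
  inner x y := charForm ψ ((PreEll.of ψ).symm x) ((PreEll.of ψ).symm y)
  conj_inner_symm _ _ := charForm_conj_symm ψ _ _
  re_inner_nonneg x := (RCLike.nonneg_iff.mp (ψ.posType.2 ((PreEll.of ψ).symm x))).1
  add_left _ _ _ := charForm_add_left ψ _ _ _
  smul_left _ _ _ := charForm_smul_left ψ _ _ _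

instance (ψ : GroupCharacter G) : SeminormedAddCommGroup (PreEll ψ) :=
  InnerProductSpace.Core.toSeminormedAddCommGroup (c := preCore ψ)

instance (ψ : GroupCharacter G) : InnerProductSpace ℂ (PreEll ψ) :=
  InnerProductSpace.ofCore (preCore ψ)

/-- The Hilbert space `ℓ^ψ(G)`: the (Hausdorff) completion of `ℂ[G]` with respect to the
semi-definite inner product given by `ψ`. -/
abbrev Ell (ψ : GroupCharacter G) : Type u := UniformSpace.Completion (PreEll ψ)

/-- The image of `1 ∈ ℂ[G]` in `ℓ^ψ(G)`, which is the trace vector. -/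
def Ell.one (ψ : GroupCharacter G) : Ell ψ :=
  (PreEll.of ψ (Finsupp.single 1 1) : PreEll ψ)

/-- Right translation `x ↦ x * g` on `ℂ[G]`, an isometry. -/
def preRight (ψ : GroupCharacter G) (g : G) : PreEll ψ →ₗᵢ[ℂ] PreEll ψ :=
  LinearMap.isometryOfInner
    ((PreEll.of ψ).toLinearMap ∘ₗ Finsupp.lmapDomain ℂ ℂ (fun h : G => h * g) ∘ₗ
      (PreEll.of ψ).symm.toLinearMap)
    fun x y => charForm_translate ψ g ((PreEll.of ψ).symm x) ((PreEll.of ψ).symm y)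

/-- Right multiplication by an element `a` of the group ring on `ℓ^ψ(G)`. -/
def rightMul (ψ : GroupCharacter G) (a : MonoidAlgebra ℂ G) : Ell ψ →L[ℂ] Ell ψ :=
  a.coeff.sum fun g c => c • (preRight ψ g).toContinuousLinearMap.completion

/-! ## The `ψ`-dimension -/

/-- The Hilbert space `ℓ^ψ(G)^ι` for a finite set `ι`. -/
abbrev EllPow (ψ : GroupCharacter G) (ι : Type u) [Fintype ι] : Type u :=
  PiLp 2 fun _ : ι => Ell ψ

/-- The `i`-th standard basis vector of `ℓ^ψ(G)^ι`. -/
def EllPow.basis (ψ : GroupCharacter G) {ι : Type u} [Fintype ι] (i : ι) : EllPow ψ ι :=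
  open scoped Classical in WithLp.toLp 2 (Pi.single i (Ell.one ψ))

/-- The `ψ`-dimension of (the closure of) a left `G`-invariant subspace `V` of `ℓ^ψ(G)^ι`: the
trace `∑ i, ⟨P e_i, e_i⟩` of the orthogonal projection `P` onto the closure of `V`. -/
def psiDim (ψ : GroupCharacter G) {ι : Type u} [Fintype ι]
    (V : Submodule ℂ (EllPow ψ ι)) : ℝ :=
  ∑ i : ι, (inner ℂ (V.topologicalClosure.starProjection (EllPow.basis ψ i))
    (EllPow.basis ψ i)).re

/-! ## Free resolutions and `ψ`-Betti numbers -/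

variable (G) in
/-- The augmentation `ℂ[G] → ℂ`, `∑ a_g g ↦ ∑ a_g`. -/
def augmentation : MonoidAlgebra ℂ G →+* ℂ :=
  (MonoidAlgebra.lift ℂ ℂ G (1 : G →* ℂ) : MonoidAlgebra ℂ G →ₐ[ℂ] ℂ).toRingHom

variable (G) in
/-- A resolution `⋯ → ℂ[G]^(ι 2) → ℂ[G]^(ι 1) → ℂ[G]^(ι 0) → ℂ → 0` of the trivial left
`ℂ[G]`-module `ℂ` by based free left `ℂ[G]`-modules. A map `ε` to the trivial module is
`ℂ[G]`-linear when it is semilinear along the augmentation. -/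
structure FreeResolution where
  ι : ℕ → Type u
  d : ∀ n, (ι (n + 1) →₀ MonoidAlgebra ℂ G) →ₗ[MonoidAlgebra ℂ G] (ι n →₀ MonoidAlgebra ℂ G)
  ε : (ι 0 →₀ MonoidAlgebra ℂ G) →ₛₗ[augmentation G] ℂ
  ε_surjective : Function.Surjective ε
  exact_zero : Function.Exact (d 0) ε
  exact_succ : ∀ n, Function.Exact (d (n + 1)) (d n)

/-- The map `ℓ^ψ(G) ⊗ ℂ[G]^(ι) → ℓ^ψ(G) ⊗ ℂ[G]^(κ)` (tensor products over `ℂ[G]`) induced by a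
homomorphism `f` of free left modules; here `ℓ^ψ(G) ⊗ ℂ[G]^(ι)` is identified with the finitely
supported functions `ι → ℓ^ψ(G)`, and `x ⊗ e_j` is sent to `∑ i, (x * (f e_j) i) ⊗ e_i`. -/
def tensorMap (ψ : GroupCharacter G) {ι κ : Type u}
    (f : (ι →₀ MonoidAlgebra ℂ G) →ₗ[MonoidAlgebra ℂ G] (κ →₀ MonoidAlgebra ℂ G)) :
    (ι →₀ Ell ψ) →ₗ[ℂ] (κ →₀ Ell ψ) :=
  Finsupp.lsum ℂ fun j : ι => (f (Finsupp.single j 1)).sum fun i a =>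
    (Finsupp.lsingle i : Ell ψ →ₗ[ℂ] (κ →₀ Ell ψ)) ∘ₗ (rightMul ψ a).toLinearMap

/-- For finite `ι`, the Hilbert space `ℓ^ψ(G)^ι` is, as a vector space, the space of finitely
supported functions. -/
def EllPow.toFinsupp (ψ : GroupCharacter G) (ι : Type u) [Fintype ι] :
    EllPow ψ ι ≃ₗ[ℂ] (ι →₀ Ell ψ) :=
  (WithLp.linearEquiv 2 ℂ (ι → Ell ψ)).trans (Finsupp.linearEquivFunOnFinite ℂ (Ell ψ) ι).symm

namespace FreeResolution

/-- The space of `k`-cycles of the complex `ℓ^ψ(G) ⊗ P` (everything for `k = 0`). -/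
def cycles (P : FreeResolution G) (ψ : GroupCharacter G) :
    (k : ℕ) → [Fintype (P.ι k)] → Submodule ℂ (EllPow ψ (P.ι k))
  | 0, _ => ⊤
  | k + 1, _ => LinearMap.ker
      (tensorMap ψ (P.d k) ∘ₗ (EllPow.toFinsupp ψ (P.ι (k + 1))).toLinearMap)

/-- The space of `k`-boundaries of the complex `ℓ^ψ(G) ⊗ P`. -/
def boundaries (P : FreeResolution G) (ψ : GroupCharacter G) (k : ℕ) [Fintype (P.ι k)] :
    Submodule ℂ (EllPow ψ (P.ι k)) :=
  LinearMap.range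
    ((EllPow.toFinsupp ψ (P.ι k)).symm.toLinearMap ∘ₗ tensorMap ψ (P.d k))

/-- The `ψ`-dimension of the reduced homology `cycles / closure of boundaries` in degree `k`, where
this quotient Hilbert module is realised as the orthogonal complement of the boundaries in the
cycles. -/
def betti (P : FreeResolution G) (ψ : GroupCharacter G) (k : ℕ) [Fintype (P.ι k)] : ℝ :=
  psiDim ψ (P.cycles ψ k ⊓ (P.boundaries ψ k)ᗮ)

end FreeResolution

/-- `b` is the `k`-th `ψ`-Betti number of `G`: there is a free resolution of `ℂ` that is finitely
generated in degrees at most `k`, and each such resolution has `ψ`-dimension of reduced homology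
equal to `b` in degree `k`. There is at most one such `b`. -/
def IsPsiBetti (ψ : GroupCharacter G) (k : ℕ) (b : ℝ) : Prop :=
  (∃ P : FreeResolution G, ∀ i ≤ k, Finite (P.ι i)) ∧
  ∀ (P : FreeResolution G) (_ : ∀ i ≤ k, Finite (P.ι i)) [Fintype (P.ι k)], P.betti ψ k = b

/-! ## Cycles in the Cayley graph -/

/-- The edges `(g, g * s)`, `g ∈ G`, `s ∈ S`, of the Cayley graph of `G` with respect to `S`. -/
abbrev Edge (S : Finset G) : Type u := {e : G × G // ∃ s ∈ S, e.2 = e.1 * s}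

/-- The edge `(1, s)`. -/
def edgeOne {S : Finset G} (s : S) : Edge S := ⟨(1, s.1), s.1, s.2, (one_mul _).symm⟩

/-- The boundary map `ℂ[E] → ℂ[G]`, `(g, h) ↦ h - g`. -/
def boundary (S : Finset G) : (Edge S →₀ ℂ) →ₗ[ℂ] (G →₀ ℂ) :=
  Finsupp.lmapDomain ℂ ℂ (fun e : Edge S => e.1.2) -
    Finsupp.lmapDomain ℂ ℂ (fun e : Edge S => e.1.1)

/-- The space of finite cycles in the Cayley graph. -/
def finiteCycles (S : Finset G) : Submodule ℂ (Edge S →₀ ℂ) := LinearMap.ker (boundary S)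

/-- The semi-definite inner product on `ℂ[E]`, linear in the first variable, such that
`⟨(g, g * s), (h, h * t)⟩_ψ` is `ψ (h⁻¹ * g)` if `s = t` and `0` otherwise. -/
def edgeInner (ψ : GroupCharacter G) {S : Finset G} (z w : Edge S →₀ ℂ) : ℂ :=
  open scoped Classical in
  z.sum fun e a => w.sum fun f b =>
    a * star b * if e.1.1⁻¹ * e.1.2 = f.1.1⁻¹ * f.1.2 then ψ (f.1.1⁻¹ * e.1.1) else 0

/-- The supremum of `|⟨z, v⟩_ψ|² / ⟨z, z⟩_ψ` over all finite cycles `z` with `⟨z, z⟩_ψ ≠ 0`.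
The set is bounded above by the Cauchy-Schwarz inequality, and the supremum of the empty set is
`0` by convention. -/
def cycleSup (ψ : GroupCharacter G) {S : Finset G} (v : Edge S →₀ ℂ) : ℝ :=
  sSup {r : ℝ | ∃ z ∈ finiteCycles S, edgeInner ψ z z ≠ 0 ∧
    r = ‖edgeInner ψ z v‖ ^ 2 / (edgeInner ψ z z).re}

end PsiBetti

end

noncomputable section

namespace PsiBetti

universe u

variable {G : Type u} [Group G]

/-! Take a resolution beginning with `ℂ[G]^S → ℂ[G]`, `e_s ↦ s - 1`. After tensoring with `ℓ^ψ(G)`,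
rank plus nullity of this map is `|S|`. The rank is `1 - b₀`, so `b₁` is `|S| - 1 + b₀` minus the
`ψ`-dimension of the closure of the degree-one boundaries (`betti_one_eq_sub`). By exactness these
boundaries have the same closure as the algebraic kernel of `e_s ↦ s - 1`, and identifying the edge
`(g, gs)` with `g e_s` turns that kernel into the finite cycles. If `P` projects onto the closure,
its dimension is `∑ ‖P e_s‖²`, and each `‖P e_s‖²` is the stated supremum by Cauchy-Schwarz
(`sSup_inner_sq_div_norm_sq`).

The analytic input is rank-nullity for equivariant operators (`psiDim_range`). It rests on the trace
identity `tr(ST) = tr(TS)`, which comes from the antiunitary `∑ a_g g ↦ ∑ conj(a_g) g⁻¹`, and on the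
mean ergodic theorem, which writes the projection onto `ker T` as a limit of averages of powers of
`1 - T*T`. No functional calculus or polar decomposition is used.

Independence of the resolution follows from chain maps and a chain homotopy, together with the fact
that an equivariant map injective on a closed invariant subspace cannot lower the dimension
(`psiDim_inf_orthogonal_le`). -/

/-- The canonical map from the group ring `ℂ[G]` to `ℓ^ψ(G)`. -/
def toEll (ψ : GroupCharacter G) : MonoidAlgebra ℂ G →ₗ[ℂ] Ell ψ :=
  (UniformSpace.Completion.toComplₗᵢ (𝕜 := ℂ) (E := PreEll ψ)).toLinearMap ∘ₗ
    (PreEll.of ψ).toLinearMap ∘ₗ (MonoidAlgebra.coeffLinearEquiv ℂ).toLinearMap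

lemma toEll_apply (ψ : GroupCharacter G) (a : MonoidAlgebra ℂ G) :
    toEll ψ a = ((PreEll.of ψ a.coeff : PreEll ψ) : Ell ψ) := rfl

lemma toEll_one (ψ : GroupCharacter G) : toEll ψ 1 = Ell.one ψ := rfl

lemma denseRange_toEll (ψ : GroupCharacter G) : DenseRange (toEll ψ) := by
  refine (UniformSpace.Completion.denseRange_coe (α := PreEll ψ)).mono ?_
  rintro _ ⟨x, rfl⟩
  exact ⟨.ofCoeff ((PreEll.of ψ).symm x), rfl⟩

lemma inner_toEll (ψ : GroupCharacter G) (a b : MonoidAlgebra ℂ G) :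
    inner ℂ (toEll ψ a) (toEll ψ b) = charForm ψ a.coeff b.coeff := by
  rw [toEll_apply, toEll_apply, UniformSpace.Completion.inner_coe]; rfl

/-! ### Left and right multiplication on `ℓ^ψ(G)` -/

lemma charForm_translate_left (ψ : GroupCharacter G) (g : G) (x y : G →₀ ℂ) :
    charForm ψ (x.mapDomain fun h => g * h) (y.mapDomain fun h => g * h) = charForm ψ x y := by
  have hinj : Function.Injective (fun h : G => g * h) := mul_right_injective g
  unfold charForm
  rw [Finsupp.sum_mapDomain_index_inj hinj]
  refine Finsupp.sum_congr fun k _ => ?_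
  rw [Finsupp.sum_mapDomain_index_inj hinj]
  refine Finsupp.sum_congr fun l _ => ?_
  rw [show (g * k)⁻¹ * (g * l) = k⁻¹ * l by group]

/-- Left translation `x ↦ g * x` on `ℂ[G]`, an isometry. -/
def preLeft (ψ : GroupCharacter G) (g : G) : PreEll ψ →ₗᵢ[ℂ] PreEll ψ :=
  LinearMap.isometryOfInner
    ((PreEll.of ψ).toLinearMap ∘ₗ Finsupp.lmapDomain ℂ ℂ (fun h : G => g * h) ∘ₗ
      (PreEll.of ψ).symm.toLinearMap)
    fun x y => charForm_translate_left ψ g ((PreEll.of ψ).symm x) ((PreEll.of ψ).symm y)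

/-- Left translation on `ℓ^ψ(G)`. -/
def leftMul (ψ : GroupCharacter G) (g : G) : Ell ψ →L[ℂ] Ell ψ :=
  (preLeft ψ g).toContinuousLinearMap.completion

lemma leftMul_toEll (ψ : GroupCharacter G) (g : G) (a : MonoidAlgebra ℂ G) :
    leftMul ψ g (toEll ψ a) = toEll ψ (MonoidAlgebra.single g 1 * a) := by
  rw [leftMul, toEll_apply, toEll_apply]
  refine (UniformSpace.Completion.map_coe
    (preLeft ψ g).toContinuousLinearMap.uniformContinuous _).trans ?_
  congr 1
  change PreEll.of ψ (a.coeff.mapDomain fun h => g * h) = _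
  congr 1
  ext h
  rw [MonoidAlgebra.coeff_single_mul_apply, one_mul]
  conv_lhs => rw [show h = g * (g⁻¹ * h) by group]
  exact Finsupp.mapDomain_apply (mul_right_injective g) _ _

lemma rightMul_toEll (ψ : GroupCharacter G) (a b : MonoidAlgebra ℂ G) :
    rightMul ψ b (toEll ψ a) = toEll ψ (a * b) := by
  have key : ∀ g : G, (preRight ψ g).toContinuousLinearMap.completion (toEll ψ a) =
      toEll ψ (a * MonoidAlgebra.single g 1) := by
    intro g
    rw [toEll_apply, toEll_apply]
    refine (UniformSpace.Completion.map_coe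
      (preRight ψ g).toContinuousLinearMap.uniformContinuous _).trans ?_
    congr 1
    change PreEll.of ψ (a.coeff.mapDomain fun h => h * g) = _
    congr 1
    ext h
    rw [MonoidAlgebra.coeff_mul_single_apply, mul_one]
    conv_lhs => rw [show h = (h * g⁻¹) * g by group]
    exact Finsupp.mapDomain_apply (mul_left_injective g) _ _
  have hb : b = b.coeff.sum fun g c => MonoidAlgebra.single g c := by
    ext; simp
  rw [rightMul, Finsupp.sum, sum_apply]
  conv_rhs => rw [hb, Finsupp.sum, Finset.mul_sum, map_sum]
  refine Finset.sum_congr rfl fun g _ => ?_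
  rw [smul_apply, key, ← map_smul, ← mul_smul_comm, MonoidAlgebra.smul_single,
    smul_eq_mul, mul_one]

lemma inner_leftMul (ψ : GroupCharacter G) (g : G) (x y : Ell ψ) :
    inner ℂ (leftMul ψ g x) (leftMul ψ g y) = inner ℂ x y := by
  refine UniformSpace.Completion.induction_on₂ x y
    (isClosed_eq (by fun_prop) (by fun_prop)) fun a b => ?_
  have h : ∀ a : PreEll ψ, leftMul ψ g a = (preLeft ψ g a : PreEll ψ) := fun a =>
    UniformSpace.Completion.map_coe (preLeft ψ g).toContinuousLinearMap.uniformContinuous _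
  rw [h, h, UniformSpace.Completion.inner_coe, UniformSpace.Completion.inner_coe,
    LinearIsometry.inner_map_map]

lemma leftMul_inv_leftMul (ψ : GroupCharacter G) (g : G) (x : Ell ψ) :
    leftMul ψ g⁻¹ (leftMul ψ g x) = x := by
  refine (denseRange_toEll ψ).induction_on x (isClosed_eq (by fun_prop) (by fun_prop)) fun a => ?_
  rw [leftMul_toEll, leftMul_toEll, ← mul_assoc, MonoidAlgebra.single_mul_single]
  simp [← MonoidAlgebra.one_def]

lemma leftMul_leftMul_inv (ψ : GroupCharacter G) (g : G) (x : Ell ψ) :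
    leftMul ψ g (leftMul ψ g⁻¹ x) = x := by
  simpa using leftMul_inv_leftMul ψ g⁻¹ x

lemma toEll_single (ψ : GroupCharacter G) (g : G) :
    toEll ψ (MonoidAlgebra.single g 1) = leftMul ψ g (Ell.one ψ) := by
  rw [← toEll_one, leftMul_toEll, mul_one]

lemma inner_one_one (ψ : GroupCharacter G) : inner ℂ (Ell.one ψ) (Ell.one ψ) = 1 := by
  rw [← toEll_one, inner_toEll]
  simp [MonoidAlgebra.one_def, charForm, ψ.map_one]

/-! ### The canonical conjugation -/

/-- The conjugate-linear involution `∑ a_g g ↦ ∑ conj(a_g) g⁻¹` of `ℂ[G]`. -/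
def preConj (ψ : GroupCharacter G) : PreEll ψ →+ PreEll ψ :=
  (Finsupp.mapRange.addMonoidHom (starAddEquiv (R := ℂ)).toAddMonoidHom).comp
    (Finsupp.mapDomain.addMonoidHom (fun g : G => g⁻¹))

/-- This is traciality: `ψ (k * l⁻¹) = ψ (l⁻¹ * k)` because `ψ` is a class function. -/
lemma charForm_conj (ψ : GroupCharacter G) (x y : G →₀ ℂ) :
    charForm ψ (Finsupp.mapRange star (star_zero ℂ) (Finsupp.mapDomain (fun g : G => g⁻¹) x))
      (Finsupp.mapRange star (star_zero ℂ) (Finsupp.mapDomain (fun g : G => g⁻¹) y)) =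
    charForm ψ y x := by
  have hinj : Function.Injective fun g : G => g⁻¹ := inv_injective
  unfold charForm
  rw [Finsupp.sum_mapRange_index (by simp), Finsupp.sum_mapDomain_index_inj hinj,
    Finsupp.sum_comm y x]
  refine Finsupp.sum_congr fun k _ => ?_
  rw [Finsupp.sum_mapRange_index (by simp), Finsupp.sum_mapDomain_index_inj hinj]
  refine Finsupp.sum_congr fun l _ => ?_
  have h := ψ.map_conj (l⁻¹ * k) k
  rw [show k * (l⁻¹ * k) * k⁻¹ = k⁻¹⁻¹ * l⁻¹ by group] at h
  rw [h, star_star]; ring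

lemma inner_preConj (ψ : GroupCharacter G) (x y : PreEll ψ) :
    inner ℂ (preConj ψ x) (preConj ψ y) = inner ℂ y x :=
  charForm_conj ψ ((PreEll.of ψ).symm x) ((PreEll.of ψ).symm y)

lemma isometry_preConj (ψ : GroupCharacter G) : Isometry (preConj ψ) := by
  refine AddMonoidHomClass.isometry_of_norm _ fun x => ?_
  rw [norm_eq_sqrt_re_inner (𝕜 := ℂ), inner_preConj, ← norm_eq_sqrt_re_inner]

/-- The extension of the involution of `ℂ[G]` to `ℓ^ψ(G)`. -/
def conjEll (ψ : GroupCharacter G) : Ell ψ → Ell ψ := UniformSpace.Completion.map (preConj ψ)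

lemma continuous_conjEll (ψ : GroupCharacter G) : Continuous (conjEll ψ) :=
  UniformSpace.Completion.continuous_map

lemma inner_conjEll (ψ : GroupCharacter G) (x y : Ell ψ) :
    inner ℂ (conjEll ψ x) (conjEll ψ y) = inner ℂ y x := by
  have := continuous_conjEll ψ
  refine UniformSpace.Completion.induction_on₂ x y
    (isClosed_eq (by fun_prop) (by fun_prop)) fun a b => ?_
  have h : ∀ a : PreEll ψ, conjEll ψ a = (preConj ψ a : PreEll ψ) := fun a =>
    UniformSpace.Completion.map_coe (isometry_preConj ψ).uniformContinuous _
  rw [h, h, UniformSpace.Completion.inner_coe, UniformSpace.Completion.inner_coe, inner_preConj]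

lemma conjEll_leftMul_one (ψ : GroupCharacter G) (g : G) :
    conjEll ψ (leftMul ψ g (Ell.one ψ)) = leftMul ψ g⁻¹ (Ell.one ψ) := by
  rw [← toEll_single, ← toEll_single, toEll_apply, toEll_apply]
  refine (UniformSpace.Completion.map_coe (isometry_preConj ψ).uniformContinuous _).trans ?_
  congr 1
  change Finsupp.mapRange star (star_zero ℂ)
    (Finsupp.mapDomain (fun g : G => g⁻¹) (Finsupp.single g (1 : ℂ))) = Finsupp.single g⁻¹ 1
  simp

lemma Ell.ext_inner_translates (ψ : GroupCharacter G) {x y : Ell ψ}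
    (h : ∀ g : G, inner ℂ x (leftMul ψ g (Ell.one ψ)) = inner ℂ y (leftMul ψ g (Ell.one ψ))) :
    x = y := by
  refine ext_inner_right ℂ fun v => ?_
  refine (denseRange_toEll ψ).induction_on v (isClosed_eq (by fun_prop) (by fun_prop)) fun a => ?_
  induction a using MonoidAlgebra.induction_linear with
  | zero => simp
  | add a b ha hb => rw [map_add, inner_add_right, inner_add_right, ha, hb]
  | single g c =>
    have : MonoidAlgebra.single g c = c • MonoidAlgebra.single g (1 : ℂ) := by simp
    rw [this, map_smul, inner_smul_right, inner_smul_right, toEll_single, h]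

/-! ### Equivariant operators and the trace -/

/-- Left translation on `ℓ^ψ(G)^ι`. -/
def leftPow (ψ : GroupCharacter G) {ι : Type u} [Fintype ι] (g : G) :
    EllPow ψ ι →L[ℂ] EllPow ψ ι :=
  (PiLp.continuousLinearEquiv 2 ℂ fun _ : ι => Ell ψ).symm.toContinuousLinearMap ∘L
    ContinuousLinearMap.pi fun i => leftMul ψ g ∘L PiLp.proj 2 (fun _ : ι => Ell ψ) i

@[simp]
lemma leftPow_apply (ψ : GroupCharacter G) {ι : Type u} [Fintype ι] (g : G) (x : EllPow ψ ι)
    (i : ι) : leftPow ψ g x i = leftMul ψ g (x i) := rfl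

lemma leftPow_leftPow_inv (ψ : GroupCharacter G) {ι : Type u} [Fintype ι] (g : G)
    (x : EllPow ψ ι) : leftPow ψ g (leftPow ψ g⁻¹ x) = x := by
  ext i; simp [leftMul_leftMul_inv]

lemma inner_leftPow (ψ : GroupCharacter G) {ι : Type u} [Fintype ι] (g : G)
    (x y : EllPow ψ ι) : inner ℂ (leftPow ψ g x) (leftPow ψ g y) = inner ℂ x y := by
  simp [PiLp.inner_apply, inner_leftMul]

lemma inner_leftPow_left (ψ : GroupCharacter G) {ι : Type u} [Fintype ι] (g : G)
    (x y : EllPow ψ ι) : inner ℂ (leftPow ψ g x) y = inner ℂ x (leftPow ψ g⁻¹ y) := by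
  conv_lhs => rw [← leftPow_leftPow_inv ψ g y, inner_leftPow]

/-- Bounded operators that commute with the left translations. -/
def IsEquivariant (ψ : GroupCharacter G) {ι κ : Type u} [Fintype ι] [Fintype κ]
    (T : EllPow ψ ι →L[ℂ] EllPow ψ κ) : Prop :=
  ∀ (g : G) (x : EllPow ψ ι), T (leftPow ψ g x) = leftPow ψ g (T x)

/-- Subspaces that are invariant under the left translations. -/
def IsInvariant (ψ : GroupCharacter G) {ι : Type u} [Fintype ι]
    (V : Submodule ℂ (EllPow ψ ι)) : Prop :=
  ∀ (g : G), ∀ x ∈ V, leftPow ψ g x ∈ V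

section

variable {ψ : GroupCharacter G} {ι κ μ : Type u} [Fintype ι] [Fintype κ] [Fintype μ]

lemma IsEquivariant.comp {S : EllPow ψ κ →L[ℂ] EllPow ψ μ} {T : EllPow ψ ι →L[ℂ] EllPow ψ κ}
    (hS : IsEquivariant ψ S) (hT : IsEquivariant ψ T) : IsEquivariant ψ (S ∘L T) := fun g x => by
  rw [ContinuousLinearMap.comp_apply, ContinuousLinearMap.comp_apply, hT, hS]

lemma IsEquivariant.adjoint {T : EllPow ψ ι →L[ℂ] EllPow ψ κ} (hT : IsEquivariant ψ T) :
    IsEquivariant ψ (ContinuousLinearMap.adjoint T) := fun g x => by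
  refine ext_inner_right ℂ fun v => ?_
  rw [ContinuousLinearMap.adjoint_inner_left, inner_leftPow_left, inner_leftPow_left,
    ContinuousLinearMap.adjoint_inner_left, hT]

lemma IsInvariant.orthogonal {V : Submodule ℂ (EllPow ψ ι)} (hV : IsInvariant ψ V) :
    IsInvariant ψ Vᗮ := fun g x hx v hv => by
  have := hx _ (hV g⁻¹ v hv)
  rwa [inner_leftPow_left, inv_inv] at this

lemma IsInvariant.starProjection {V : Submodule ℂ (EllPow ψ ι)} [V.HasOrthogonalProjection]
    (hV : IsInvariant ψ V) : IsEquivariant ψ V.starProjection := fun g x => by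
  refine Submodule.eq_starProjection_of_mem_orthogonal (hV g _ (V.starProjection_apply_mem x)) ?_
  rw [← map_sub]
  exact hV.orthogonal g _ (V.sub_starProjection_mem_orthogonal x)

lemma IsEquivariant.isInvariant_ker {T : EllPow ψ ι →L[ℂ] EllPow ψ κ} (hT : IsEquivariant ψ T) :
    IsInvariant ψ T.ker := fun g x hx => by
  rw [LinearMap.mem_ker] at hx ⊢
  change T _ = 0
  rw [hT, show T x = 0 from hx, map_zero]

lemma IsInvariant.inf {V W : Submodule ℂ (EllPow ψ ι)} (hV : IsInvariant ψ V)
    (hW : IsInvariant ψ W) : IsInvariant ψ (V ⊓ W) := fun g x hx => ⟨hV g x hx.1, hW g x hx.2⟩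

lemma EllPow.basis_apply (i j : ι) [Decidable (j = i)] :
    EllPow.basis ψ i j = if j = i then Ell.one ψ else 0 := by
  simp [EllPow.basis]

lemma inner_leftPow_basis (g : G) (i : ι) (x : EllPow ψ ι) :
    inner ℂ x (leftPow ψ g (EllPow.basis ψ i)) = inner ℂ (x i) (leftMul ψ g (Ell.one ψ)) := by
  classical
  rw [PiLp.inner_apply, Finset.sum_eq_single i]
  · simp [EllPow.basis_apply]
  · intro j _ hj; simp [EllPow.basis_apply, hj]
  · simp

/-- The involution sends matrix entries of `T` to those of its adjoint. Both sides pair equally with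
every translate of the trace vector, because `T` commutes with translations and the involution takes
the translate by `g` to that by `g⁻¹`. -/
lemma IsEquivariant.conjEll_apply {T : EllPow ψ ι →L[ℂ] EllPow ψ κ} (hT : IsEquivariant ψ T)
    (i : ι) (k : κ) : conjEll ψ (T (EllPow.basis ψ i) k) =
      ContinuousLinearMap.adjoint T (EllPow.basis ψ k) i := by
  refine Ell.ext_inner_translates ψ fun g => ?_
  rw [← inner_leftPow_basis, ContinuousLinearMap.adjoint_inner_left, hT,
    ← inv_inv g, ← conjEll_leftMul_one, inner_conjEll, inv_inv,
    ← inner_conj_symm, ← inner_leftPow_basis, ← inner_leftPow_left, inner_conj_symm]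

/-- The trace of an operator on `ℓ^ψ(G)^ι`. -/
def trace (T : EllPow ψ ι →L[ℂ] EllPow ψ ι) : ℂ :=
  ∑ i : ι, inner ℂ (EllPow.basis ψ i) (T (EllPow.basis ψ i))

/-- Both traces expand into double sums of inner products of matrix entries. The antiunitary
involution swaps the two arguments of each inner product and replaces entries by those of the
adjoints, which matches the sums term by term. -/
lemma trace_comp_comm {S : EllPow ψ κ →L[ℂ] EllPow ψ ι} {T : EllPow ψ ι →L[ℂ] EllPow ψ κ}
    (hS : IsEquivariant ψ S) (hT : IsEquivariant ψ T) : trace (S ∘L T) = trace (T ∘L S) := by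
  have h₁ : trace (S ∘L T) = ∑ i : ι, ∑ k : κ,
      inner ℂ (ContinuousLinearMap.adjoint S (EllPow.basis ψ i) k) (T (EllPow.basis ψ i) k) := by
    refine Finset.sum_congr rfl fun i _ => ?_
    rw [ContinuousLinearMap.comp_apply, ← ContinuousLinearMap.adjoint_inner_left, PiLp.inner_apply]
  have h₂ : trace (T ∘L S) = ∑ k : κ, ∑ i : ι,
      inner ℂ (ContinuousLinearMap.adjoint T (EllPow.basis ψ k) i) (S (EllPow.basis ψ k) i) := by
    refine Finset.sum_congr rfl fun i _ => ?_
    rw [ContinuousLinearMap.comp_apply, ← ContinuousLinearMap.adjoint_inner_left, PiLp.inner_apply]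
  rw [h₁, h₂, Finset.sum_comm]
  refine Finset.sum_congr rfl fun k _ => Finset.sum_congr rfl fun i _ => ?_
  have := hS.adjoint.conjEll_apply i k
  rw [ContinuousLinearMap.adjoint_adjoint] at this
  rw [← hT.conjEll_apply, ← this, inner_conjEll]

lemma trace_id : trace (ContinuousLinearMap.id ℂ (EllPow ψ ι)) = Fintype.card ι := by
  classical
  have : ∀ i : ι, inner ℂ (EllPow.basis ψ i) (EllPow.basis ψ i) = (1 : ℂ) := fun i => by
    rw [PiLp.inner_apply, Finset.sum_eq_single i]
    · simp only [EllPow.basis_apply, if_true, inner_one_one]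
    · intro j _ hj; simp [EllPow.basis_apply, hj]
    · simp
  simp only [trace, ContinuousLinearMap.id_apply, this]
  simp

end

/-! ### Properties of the `ψ`-dimension -/

section

variable {ψ : GroupCharacter G} {ι κ : Type u} [Fintype ι] [Fintype κ]

instance (V : Submodule ℂ (EllPow ψ ι)) : Vᗮ.HasOrthogonalProjection :=
  have : CompleteSpace Vᗮ := V.isClosed_orthogonal.completeSpace_coe
  Submodule.HasOrthogonalProjection.ofCompleteSpace Vᗮ

lemma starProjection_congr {U V : Submodule ℂ (EllPow ψ ι)} [U.HasOrthogonalProjection]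
    [V.HasOrthogonalProjection] (h : U = V) : U.starProjection = V.starProjection := by
  subst h; rfl

lemma psiDim_topologicalClosure (V : Submodule ℂ (EllPow ψ ι)) :
    psiDim ψ V.topologicalClosure = psiDim ψ V := by
  have h : V.topologicalClosure.topologicalClosure = V.topologicalClosure :=
    V.isClosed_topologicalClosure.submodule_topologicalClosure_eq
  unfold psiDim
  simp_rw [h]

lemma psiDim_eq_trace (V : Submodule ℂ (EllPow ψ ι)) :
    psiDim ψ V = (trace V.topologicalClosure.starProjection).re := by
  unfold psiDim trace
  rw [Complex.re_sum]
  refine Finset.sum_congr rfl fun i _ => ?_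
  rw [Submodule.inner_starProjection_left_eq_right]

lemma psiDim_eq_sum_norm_sq (V : Submodule ℂ (EllPow ψ ι)) :
    psiDim ψ V = ∑ i, ‖V.topologicalClosure.starProjection (EllPow.basis ψ i)‖ ^ 2 :=
  Finset.sum_congr rfl fun i _ => by
    exact V.topologicalClosure.re_inner_starProjection_eq_normSq (𝕜 := ℂ) _

lemma psiDim_eq_trace_of_isClosed {V : Submodule ℂ (EllPow ψ ι)} [V.HasOrthogonalProjection]
    (hV : IsClosed (V : Set (EllPow ψ ι))) : psiDim ψ V = (trace V.starProjection).re := by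
  rw [psiDim_eq_trace]
  simp_rw [hV.submodule_topologicalClosure_eq]

lemma trace_sub (S T : EllPow ψ ι →L[ℂ] EllPow ψ ι) : trace (S - T) = trace S - trace T := by
  simp [trace]

lemma psiDim_orthogonal (V : Submodule ℂ (EllPow ψ ι)) :
    psiDim ψ Vᗮ = Fintype.card ι - psiDim ψ V := by
  rw [psiDim_eq_trace_of_isClosed V.isClosed_orthogonal, psiDim_eq_trace V]
  have h : Vᗮ.starProjection = 1 - V.topologicalClosure.starProjection := by
    rw [← Submodule.starProjection_orthogonal']
    exact starProjection_congr V.orthogonal_closure.symm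
  rw [h, trace_sub, ContinuousLinearMap.one_def, trace_id]
  simp

lemma psiDim_mono {V W : Submodule ℂ (EllPow ψ ι)} (h : V ≤ W.topologicalClosure) :
    psiDim ψ V ≤ psiDim ψ W := by
  rw [psiDim_eq_sum_norm_sq, psiDim_eq_sum_norm_sq]
  have h' : V.topologicalClosure ≤ W.topologicalClosure :=
    V.topologicalClosure_minimal h W.isClosed_topologicalClosure
  gcongr with i
  rw [← Submodule.starProjection_comp_starProjection_of_le h']
  exact Submodule.norm_starProjection_apply_le _ _

/-- The projection onto `Z ⊓ Bᗮ` is the projection onto `Z` minus the one onto the closure of `B`.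
-/
lemma psiDim_inf_orthogonal {Z B : Submodule ℂ (EllPow ψ ι)} (hZ : IsClosed (Z : Set (EllPow ψ ι)))
    (h : B ≤ Z) : psiDim ψ (Z ⊓ Bᗮ) = psiDim ψ Z - psiDim ψ B := by
  have : CompleteSpace Z := hZ.completeSpace_coe
  have hc : IsClosed ((Z ⊓ Bᗮ : Submodule ℂ (EllPow ψ ι)) : Set (EllPow ψ ι)) :=
    hZ.inter B.isClosed_orthogonal
  have : CompleteSpace (Z ⊓ Bᗮ : Submodule ℂ (EllPow ψ ι)) := hc.completeSpace_coe
  rw [psiDim_eq_trace_of_isClosed hc, psiDim_eq_trace_of_isClosed hZ, psiDim_eq_trace B,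
    ← Complex.sub_re, ← trace_sub]
  congr 2
  ext1 x
  have hB : B.topologicalClosure ≤ Z := B.topologicalClosure_minimal h hZ
  refine (Submodule.eq_starProjection_of_mem_orthogonal ⟨?_, ?_⟩ ?_)
  · exact Z.sub_mem (Z.starProjection_apply_mem x)
      (hB (B.topologicalClosure.starProjection_apply_mem x))
  · have h₁ := B.topologicalClosure.sub_starProjection_mem_orthogonal x
    rw [Submodule.orthogonal_closure] at h₁
    have h₂ := Submodule.orthogonal_le h (Z.sub_starProjection_mem_orthogonal x)
    convert! Bᗮ.sub_mem h₁ h₂ using 1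
    simp
  · have h₁ := Submodule.orthogonal_le (inf_le_left : Z ⊓ Bᗮ ≤ Z)
      (Z.sub_starProjection_mem_orthogonal x)
    have h₂ : B.topologicalClosure.starProjection x ∈ (Z ⊓ Bᗮ)ᗮ := by
      refine Submodule.orthogonal_le (inf_le_right : Z ⊓ Bᗮ ≤ Bᗮ) ?_
      rw [Submodule.orthogonal_orthogonal_eq_closure]
      exact B.topologicalClosure.starProjection_apply_mem x
    convert! (Z ⊓ Bᗮ)ᗮ.add_mem h₁ h₂ using 1
    simp only [sub_apply]
    abel

/-! ### Rank and nullity -/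

lemma IsEquivariant.id : IsEquivariant ψ (ContinuousLinearMap.id ℂ (EllPow ψ ι)) := fun _ _ => rfl

lemma IsEquivariant.sub {S T : EllPow ψ ι →L[ℂ] EllPow ψ κ} (hS : IsEquivariant ψ S)
    (hT : IsEquivariant ψ T) : IsEquivariant ψ (S - T) := fun g x => by
  simp [hS g x, hT g x]

lemma IsEquivariant.pow {T : EllPow ψ ι →L[ℂ] EllPow ψ ι} (hT : IsEquivariant ψ T) (n : ℕ) :
    IsEquivariant ψ (T ^ n) := by
  induction n with
  | zero => exact IsEquivariant.id
  | succ n ih => rw [pow_succ]; exact ih.comp hT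

open Filter Topology in
-- Mean ergodic theorem for the contraction `1 - T*T`: its fixed vectors are those with `T*T x = 0`,
-- that is, `ker T`.
lemma tendsto_trace_average {T : EllPow ψ ι →L[ℂ] EllPow ψ κ} (hT : ‖T‖ ≤ 1) :
    Tendsto (fun n : ℕ => (n : ℂ)⁻¹ * ∑ k ∈ Finset.range n,
      trace ((ContinuousLinearMap.id ℂ _ - ContinuousLinearMap.adjoint T ∘L T) ^ k)) atTop
      (𝓝 (trace T.ker.starProjection)) := by
  set f := ContinuousLinearMap.id ℂ _ - ContinuousLinearMap.adjoint T ∘L T with hf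
  have hker : f.eqLocus (1 : EllPow ψ ι →L[ℂ] EllPow ψ ι) = T.ker := by
    ext x
    have h₁ : x ∈ f.eqLocus (1 : EllPow ψ ι →L[ℂ] EllPow ψ ι) ↔
        ContinuousLinearMap.adjoint T (T x) = 0 := by
      change f x = x ↔ _
      simp [hf]
    rw [h₁]
    constructor
    · intro h
      have : inner ℂ (T x) (T x) = 0 := by
        rw [← ContinuousLinearMap.adjoint_inner_left, h, inner_zero_left]
      exact inner_self_eq_zero.mp this
    · intro h
      rw [show T x = 0 from h, map_zero]
  have hnorm : ‖f‖ ≤ 1 := by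
    refine ContinuousLinearMap.opNorm_le_bound _ zero_le_one fun x => ?_
    rw [one_mul]
    refine le_of_sq_le_sq ?_ (norm_nonneg _)
    have e : f x = x - ContinuousLinearMap.adjoint T (T x) := by simp [hf]
    -- The bound comes from `‖x - T*Tx‖² = ‖x‖² - 2‖Tx‖² + ‖T*Tx‖²`, with `‖T*Tx‖ ≤ ‖Tx‖`.
    have h₁ : ‖ContinuousLinearMap.adjoint T (T x)‖ ≤ ‖T x‖ := by
      refine (ContinuousLinearMap.le_opNorm _ _).trans ?_
      rw [LinearIsometryEquiv.norm_map]
      exact mul_le_of_le_one_left (norm_nonneg _) hT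
    have h₂ : RCLike.re (inner ℂ x (ContinuousLinearMap.adjoint T (T x))) = ‖T x‖ ^ 2 := by
      rw [ContinuousLinearMap.adjoint_inner_right, inner_self_eq_norm_sq]
    rw [e, norm_sub_sq (𝕜 := ℂ), h₂]
    nlinarith [norm_nonneg (ContinuousLinearMap.adjoint T (T x)), norm_nonneg (T x)]
  have key : ∀ x, Tendsto (birkhoffAverage ℂ f _root_.id · x) atTop
      (𝓝 (T.ker.starProjection x)) := by
    intro x
    have := f.tendsto_birkhoffAverage_orthogonalProjection hnorm x
    rw [← starProjection_congr hker]
    exact this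
  have h := tendsto_finsetSum (Finset.univ : Finset ι) fun i _ =>
    (tendsto_const_nhds (x := EllPow.basis ψ i)).inner (𝕜 := ℂ) (key (EllPow.basis ψ i))
  refine h.congr fun n => ?_
  simp only [trace, birkhoffAverage, birkhoffSum, inner_smul_right, inner_sum]
  rw [← Finset.mul_sum, Finset.sum_comm]
  simp

/-- With `f = 1 - T*T` and `g = 1 - TT*`, one has `T fⁿ = gⁿ T`. Passing from `n` to `n + 1`
therefore subtracts `T*(T fⁿ)` on one side and `(T fⁿ)T*` on the other, which have equal trace. -/
lemma trace_pow_sub_card {T : EllPow ψ ι →L[ℂ] EllPow ψ κ} (hT : IsEquivariant ψ T) (n : ℕ) :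
    trace ((ContinuousLinearMap.id ℂ _ - ContinuousLinearMap.adjoint T ∘L T) ^ n) - Fintype.card ι =
    trace ((ContinuousLinearMap.id ℂ _ - T ∘L ContinuousLinearMap.adjoint T) ^ n) -
      Fintype.card κ := by
  set f := ContinuousLinearMap.id ℂ _ - ContinuousLinearMap.adjoint T ∘L T with hf
  set g := ContinuousLinearMap.id ℂ _ - T ∘L ContinuousLinearMap.adjoint T with hg
  have hfe : IsEquivariant ψ f := IsEquivariant.id.sub (hT.adjoint.comp hT)
  have comm : ∀ n : ℕ, T ∘L (f ^ n) = (g ^ n) ∘L T := by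
    intro n
    induction n with
    | zero => rfl
    | succ n ih =>
      rw [pow_succ, pow_succ, ContinuousLinearMap.mul_def, ← ContinuousLinearMap.comp_assoc, ih,
        ContinuousLinearMap.mul_def, ContinuousLinearMap.comp_assoc,
        ContinuousLinearMap.comp_assoc]
      congr 1
      ext1 x
      simp [hf, hg]
  induction n with
  | zero => rw [pow_zero, pow_zero, ContinuousLinearMap.one_def, ContinuousLinearMap.one_def,
      trace_id, trace_id, sub_self, sub_self]
  | succ n ih =>
    have e₁ : f ^ (n + 1) = f ^ n - ContinuousLinearMap.adjoint T ∘L (T ∘L (f ^ n)) := by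
      rw [pow_succ', ContinuousLinearMap.mul_def]
      ext1 x; simp [hf]
    have e₂ : g ^ (n + 1) = g ^ n - (T ∘L (f ^ n)) ∘L ContinuousLinearMap.adjoint T := by
      rw [comm, pow_succ, ContinuousLinearMap.mul_def]
      ext1 x; simp [hg]
    rw [e₁, e₂, trace_sub, trace_sub, trace_comp_comm hT.adjoint (hT.comp (hfe.pow n)),
      sub_right_comm, ih, sub_right_comm]

lemma psiDim_ker_adjoint_of_norm_le_one {T : EllPow ψ ι →L[ℂ] EllPow ψ κ}
    (hT : IsEquivariant ψ T) (h : ‖T‖ ≤ 1) :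
    psiDim ψ T.ker - Fintype.card ι =
      psiDim ψ (ContinuousLinearMap.adjoint T).ker - Fintype.card κ := by
  have h₁ := tendsto_trace_average h
  have h₂ := tendsto_trace_average (T := ContinuousLinearMap.adjoint T)
    (by rwa [LinearIsometryEquiv.norm_map])
  rw [ContinuousLinearMap.adjoint_adjoint] at h₂
  have h₃ := (h₁.sub h₂).congr' (f₂ := fun _ => (Fintype.card ι : ℂ) - Fintype.card κ) (by
    -- For `n ≥ 1` the average of the constant difference is that constant; at `n = 0` it would be
    -- `0`.
    filter_upwards [Filter.eventually_gt_atTop 0] with n hn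
    rw [← mul_sub, ← Finset.sum_sub_distrib]
    rw [Finset.sum_congr rfl fun k _ => sub_eq_sub_iff_sub_eq_sub.mp (trace_pow_sub_card hT k)]
    have : (n : ℂ) ≠ 0 := by exact_mod_cast hn.ne'
    rw [Finset.sum_const, Finset.card_range, nsmul_eq_mul, inv_mul_cancel_left₀ this])
  have h₄ := congrArg Complex.re (tendsto_nhds_unique h₃ tendsto_const_nhds)
  rw [psiDim_eq_trace_of_isClosed T.isClosed_ker,
    psiDim_eq_trace_of_isClosed (ContinuousLinearMap.adjoint T).isClosed_ker]
  simp only [Complex.sub_re, Complex.natCast_re] at h₄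
  linarith

lemma psiDim_ker_adjoint {T : EllPow ψ ι →L[ℂ] EllPow ψ κ} (hT : IsEquivariant ψ T) :
    psiDim ψ T.ker - Fintype.card ι =
      psiDim ψ (ContinuousLinearMap.adjoint T).ker - Fintype.card κ := by
  -- Rescaling to a contraction changes neither kernel; the `+ 1` avoids a separate case `T = 0`.
  set c : ℂ := (((‖T‖ + 1)⁻¹ : ℝ) : ℂ) with hc
  have hpos : 0 < ‖T‖ + 1 := by positivity
  have hc0 : c ≠ 0 := by rw [hc]; exact_mod_cast (inv_pos.mpr hpos).ne'
  have h := psiDim_ker_adjoint_of_norm_le_one (T := c • T)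
    (fun g x => by simp [hT g x]) (by
      refine ContinuousLinearMap.opNorm_le_bound _ zero_le_one fun x => ?_
      rw [smul_apply, norm_smul, hc, Complex.norm_real, Real.norm_of_nonneg (by positivity),
        one_mul, inv_mul_le_iff₀ hpos]
      refine (T.le_opNorm x).trans ?_
      gcongr
      linarith)
  have e₁ : (c • T).ker = T.ker := by ext x; simp [hc0]
  have e₂ : (ContinuousLinearMap.adjoint (c • T)).ker = (ContinuousLinearMap.adjoint T).ker := by
    rw [← ContinuousLinearMap.orthogonal_range, ← ContinuousLinearMap.orthogonal_range]
    congr 1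
    exact LinearMap.range_smul (T : EllPow ψ ι →ₗ[ℂ] EllPow ψ κ) c hc0
  rwa [e₁, e₂] at h

/-- The orthogonal complement of the range is the kernel of the adjoint. -/
lemma psiDim_range {T : EllPow ψ ι →L[ℂ] EllPow ψ κ} (hT : IsEquivariant ψ T) :
    psiDim ψ T.range = Fintype.card ι - psiDim ψ T.ker := by
  have h₁ := psiDim_orthogonal T.range
  rw [T.orthogonal_range] at h₁
  linarith [psiDim_ker_adjoint hT]

/-- If `b` is a left inverse of `a` on `Z` modulo the closure of `B`, then `a` induces an injection
on reduced homology. Compress `a` to an operator `T` from `Z ⊓ Bᗮ` to `Z' ⊓ B'ᗮ` and apply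
rank-nullity. Only kernels are traced through `b`, so `b` need not be equivariant. -/
lemma psiDim_inf_orthogonal_le {Z B : Submodule ℂ (EllPow ψ ι)} {Z' B' : Submodule ℂ (EllPow ψ κ)}
    (hZ : IsInvariant ψ Z) (hB : IsInvariant ψ B) (hB' : IsInvariant ψ B')
    (hZc : IsClosed (Z : Set (EllPow ψ ι))) (hBZ' : B' ≤ Z')
    (hZc' : IsClosed (Z' : Set (EllPow ψ κ)))
    {a : EllPow ψ ι →L[ℂ] EllPow ψ κ} (ha : IsEquivariant ψ a) (b : EllPow ψ κ →L[ℂ] EllPow ψ ι)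
    (haZ : ∀ x ∈ Z, a x ∈ Z') (hbB : ∀ x ∈ B', b x ∈ B.topologicalClosure)
    (hba : ∀ x ∈ Z, b (a x) - x ∈ B.topologicalClosure) :
    psiDim ψ (Z ⊓ Bᗮ) ≤ psiDim ψ (Z' ⊓ B'ᗮ) := by
  have hc : IsClosed ((Z ⊓ Bᗮ : Submodule ℂ (EllPow ψ ι)) : Set (EllPow ψ ι)) :=
    hZc.inter B.isClosed_orthogonal
  have : CompleteSpace (Z ⊓ Bᗮ : Submodule ℂ (EllPow ψ ι)) := hc.completeSpace_coe
  set T : EllPow ψ ι →L[ℂ] EllPow ψ κ := B'ᗮ.starProjection ∘L a ∘L (Z ⊓ Bᗮ).starProjection with hT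
  have hTe : IsEquivariant ψ T :=
    hB'.orthogonal.starProjection.comp (ha.comp (hZ.inf hB.orthogonal).starProjection)
  have hBc' : B'.topologicalClosure ≤ Z' := B'.topologicalClosure_minimal hBZ' hZc'
  have hortho : ∀ y, y - B'ᗮ.starProjection y ∈ B'.topologicalClosure := fun y => by
    rw [← Submodule.orthogonal_orthogonal_eq_closure]
    exact B'ᗮ.sub_starProjection_mem_orthogonal y
  have hrange : T.range ≤ Z' ⊓ B'ᗮ := by
    rintro _ ⟨x, rfl⟩
    refine ⟨?_, B'ᗮ.starProjection_apply_mem _⟩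
    have h₁ := haZ _ ((Z ⊓ Bᗮ).starProjection_apply_mem x).1
    have h₂ := Z'.sub_mem h₁ (hBc' (hortho (a ((Z ⊓ Bᗮ).starProjection x))))
    rwa [sub_sub_cancel] at h₂
  have hker : T.ker ≤ (Z ⊓ Bᗮ)ᗮ := by
    intro x hx
    set y := (Z ⊓ Bᗮ).starProjection x with hy
    have hyZ : y ∈ Z ⊓ Bᗮ := (Z ⊓ Bᗮ).starProjection_apply_mem x
    -- If `T x = 0`, then `a y` lies in the closure of `B'`, so `b (a y)`, and hence `y`, lies in
    -- the closure of `B`; but `y` is also orthogonal to `B`.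
    have h₁ := hortho (a y)
    rw [show B'ᗮ.starProjection (a y) = 0 from hx, sub_zero] at h₁
    have h₂ : b (a y) ∈ B.topologicalClosure.topologicalClosure :=
      map_mem_closure b.continuous h₁ fun z hz => hbB z hz
    rw [B.isClosed_topologicalClosure.submodule_topologicalClosure_eq] at h₂
    have h₃ := B.topologicalClosure.sub_mem h₂ (hba y hyZ.1)
    rw [sub_sub_cancel] at h₃
    have h₄ : y = 0 := by
      have h₅ := hyZ.2
      rw [← Submodule.orthogonal_closure] at h₅
      exact inner_self_eq_zero.mp (h₅ y h₃)
    rwa [hy, Submodule.starProjection_apply_eq_zero_iff] at h₄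
  have h₁ := psiDim_mono (hrange.trans (Submodule.le_topologicalClosure _))
  have h₂ := psiDim_mono (hker.trans (Submodule.le_topologicalClosure _))
  rw [psiDim_orthogonal] at h₂
  rw [psiDim_range hTe] at h₁
  linarith

end

/-! ### Operators induced by homomorphisms of free modules -/

section

variable (ψ : GroupCharacter G) {ι κ μ : Type u}

/-- The canonical map `ℂ[G]^(ι) → ℓ^ψ(G) ⊗ ℂ[G]^(ι)`. -/
def embFinsupp (ι : Type u) : (ι →₀ MonoidAlgebra ℂ G) →ₗ[ℂ] (ι →₀ Ell ψ) :=
  Finsupp.mapRange.linearMap (toEll ψ)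

lemma rightMul_zero : rightMul ψ (0 : MonoidAlgebra ℂ G) = 0 := by simp [rightMul]

lemma tensorMap_single_apply
    (f : (ι →₀ MonoidAlgebra ℂ G) →ₗ[MonoidAlgebra ℂ G] (κ →₀ MonoidAlgebra ℂ G))
    (j : ι) (y : Ell ψ) (i : κ) :
    tensorMap ψ f (Finsupp.single j y) i = rightMul ψ (f (Finsupp.single j 1) i) y := by
  classical
  rw [tensorMap, Finsupp.lsum_single, Finsupp.sum, LinearMap.sum_apply, Finsupp.finsetSum_apply,
    Finset.sum_eq_single i]
  · simp
  · intro k _ hk; simp [hk]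
  · intro h; simp [Finsupp.notMem_support_iff.mp h, rightMul_zero]

lemma tensorMap_embFinsupp
    (f : (ι →₀ MonoidAlgebra ℂ G) →ₗ[MonoidAlgebra ℂ G] (κ →₀ MonoidAlgebra ℂ G))
    (x : ι →₀ MonoidAlgebra ℂ G) :
    tensorMap ψ f (embFinsupp ψ ι x) = embFinsupp ψ κ (f x) := by
  induction x using Finsupp.induction_linear with
  | zero => simp
  | add x y hx hy => rw [map_add, map_add, map_add, map_add, hx, hy]
  | single j a =>
    ext i
    have h : embFinsupp ψ ι (Finsupp.single j a) = Finsupp.single j (toEll ψ a) := by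
      simp [embFinsupp]
    have h' : (Finsupp.single j a : ι →₀ MonoidAlgebra ℂ G) = a • Finsupp.single j 1 := by simp
    rw [h, tensorMap_single_apply, rightMul_toEll, h', map_smul]
    simp [embFinsupp]

/-- The canonical map `ℂ[G]^ι → ℓ^ψ(G)^ι`. -/
def emb (ι : Type u) [Fintype ι] : (ι →₀ MonoidAlgebra ℂ G) →ₗ[ℂ] EllPow ψ ι :=
  (EllPow.toFinsupp ψ ι).symm.toLinearMap ∘ₗ embFinsupp ψ ι

section

variable [Fintype ι] [Fintype κ] [Fintype μ]

@[simp]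
lemma emb_apply (x : ι →₀ MonoidAlgebra ℂ G) (i : ι) : emb ψ ι x i = toEll ψ (x i) := rfl

lemma denseRange_emb : DenseRange (emb ψ ι) := by
  have h₁ : DenseRange (Pi.map fun _ : ι => ⇑(toEll ψ)) :=
    DenseRange.piMap fun _ => denseRange_toEll ψ
  have h₂ := (PiLp.continuousLinearEquiv 2 ℂ fun _ : ι => Ell ψ).symm.surjective.denseRange.comp h₁
    (PiLp.continuousLinearEquiv 2 ℂ fun _ : ι => Ell ψ).symm.continuous
  refine h₂.mono ?_
  rintro _ ⟨x, rfl⟩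
  exact ⟨Finsupp.equivFunOnFinite.symm x, rfl⟩

lemma leftPow_emb (g : G) (x : ι →₀ MonoidAlgebra ℂ G) :
    leftPow ψ g (emb ψ ι x) = emb ψ ι (MonoidAlgebra.single g (1 : ℂ) • x) := by
  ext i
  simp [leftMul_toEll]

/-- The bounded operator `ℓ^ψ(G)^ι → ℓ^ψ(G)^κ` induced by a homomorphism of free modules. -/
def op (f : (ι →₀ MonoidAlgebra ℂ G) →ₗ[MonoidAlgebra ℂ G] (κ →₀ MonoidAlgebra ℂ G)) :
    EllPow ψ ι →L[ℂ] EllPow ψ κ where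
  toLinearMap := (EllPow.toFinsupp ψ κ).symm.toLinearMap ∘ₗ tensorMap ψ f ∘ₗ
    (EllPow.toFinsupp ψ ι).toLinearMap
  cont := by
    have h : ∀ x i, ((EllPow.toFinsupp ψ κ).symm (tensorMap ψ f (EllPow.toFinsupp ψ ι x))) i =
        ∑ j, rightMul ψ (f (Finsupp.single j 1) i) (x j) := by
      intro x i
      have e : EllPow.toFinsupp ψ ι x = ∑ j, Finsupp.single j (x j) :=
        (Finsupp.univ_sum_single _).symm
      rw [e, map_sum, map_sum, WithLp.ofLp_sum, Finset.sum_apply]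
      exact Finset.sum_congr rfl fun j _ => tensorMap_single_apply ψ f j (x j) i
    refine (PiLp.continuousLinearEquiv 2 ℂ fun _ : κ =>
      Ell ψ).toHomeomorph.isInducing.continuous_iff.mpr ?_
    refine continuous_pi fun i => ?_
    refine (continuous_congr fun x => h x i).mpr ?_
    fun_prop

variable (f : (ι →₀ MonoidAlgebra ℂ G) →ₗ[MonoidAlgebra ℂ G] (κ →₀ MonoidAlgebra ℂ G))

lemma op_apply (x : EllPow ψ ι) :
    op ψ f x = (EllPow.toFinsupp ψ κ).symm (tensorMap ψ f (EllPow.toFinsupp ψ ι x)) := rfl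

lemma op_emb (x : ι →₀ MonoidAlgebra ℂ G) : op ψ f (emb ψ ι x) = emb ψ κ (f x) := by
  rw [op_apply, emb, LinearMap.comp_apply, LinearEquiv.coe_coe, LinearEquiv.apply_symm_apply,
    tensorMap_embFinsupp]
  rfl

lemma isEquivariant_op : IsEquivariant ψ (op ψ f) := fun g x => by
  refine (denseRange_emb ψ).induction_on x (isClosed_eq (by fun_prop) (by fun_prop)) fun a => ?_
  rw [leftPow_emb, op_emb, op_emb, leftPow_emb, map_smul]

lemma op_comp (g : (κ →₀ MonoidAlgebra ℂ G) →ₗ[MonoidAlgebra ℂ G] (μ →₀ MonoidAlgebra ℂ G))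
    (x : EllPow ψ ι) : op ψ (g ∘ₗ f) x = op ψ g (op ψ f x) := by
  refine (denseRange_emb ψ).induction_on x (isClosed_eq (by fun_prop) (by fun_prop)) fun a => ?_
  simp only [op_emb, LinearMap.comp_apply]

lemma op_sub (f' : (ι →₀ MonoidAlgebra ℂ G) →ₗ[MonoidAlgebra ℂ G] (κ →₀ MonoidAlgebra ℂ G))
    (x : EllPow ψ ι) : op ψ (f - f') x = op ψ f x - op ψ f' x := by
  refine (denseRange_emb ψ).induction_on x (isClosed_eq (by fun_prop) (by fun_prop)) fun a => ?_
  simp only [op_emb, LinearMap.sub_apply, map_sub]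

lemma op_id (x : EllPow ψ ι) : op ψ LinearMap.id x = x := by
  refine (denseRange_emb ψ).induction_on x (isClosed_eq (by fun_prop) (by fun_prop)) fun a => ?_
  simp only [op_emb, LinearMap.id_apply]

/-- The image in `ℓ^ψ(G)^ι` of a submodule of `ℂ[G]^ι`. -/
def image (M : Submodule (MonoidAlgebra ℂ G) (ι →₀ MonoidAlgebra ℂ G)) :
    Submodule ℂ (EllPow ψ ι) :=
  (M.restrictScalars ℂ).map (emb ψ ι)

lemma isInvariant_image (M : Submodule (MonoidAlgebra ℂ G) (ι →₀ MonoidAlgebra ℂ G)) :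
    IsInvariant ψ (image ψ M) := by
  rintro g _ ⟨x, hx, rfl⟩
  exact ⟨_, M.smul_mem (MonoidAlgebra.single g (1 : ℂ)) hx, (leftPow_emb ψ g x).symm⟩

variable {f} in
-- Carries algebraic exactness, which puts values of `f` in a range, over to the completion by
-- density.
lemma op_mem_closure_image {M : Submodule (MonoidAlgebra ℂ G) (κ →₀ MonoidAlgebra ℂ G)}
    (h : ∀ x, f x ∈ M) (x : EllPow ψ ι) : op ψ f x ∈ (image ψ M).topologicalClosure := by
  refine (denseRange_emb ψ).induction_on x
    ((image ψ M).isClosed_topologicalClosure.preimage (op ψ f).continuous) fun a => ?_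
  rw [op_emb]
  exact Submodule.le_topologicalClosure _ ⟨f a, h a, rfl⟩

end

/-- Here `ι` may be infinite, as `P₂` need not be finitely generated. Hence density is applied to
one summand of the source at a time. -/
lemma closure_range_tensorMap [Fintype κ]
    (f : (ι →₀ MonoidAlgebra ℂ G) →ₗ[MonoidAlgebra ℂ G] (κ →₀ MonoidAlgebra ℂ G)) :
    (LinearMap.range ((EllPow.toFinsupp ψ κ).symm.toLinearMap ∘ₗ
      tensorMap ψ f)).topologicalClosure = (image ψ (LinearMap.range f)).topologicalClosure := by
  refine le_antisymm (Submodule.topologicalClosure_minimal _ ?_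
    (Submodule.isClosed_topologicalClosure _)) (Submodule.topologicalClosure_mono ?_)
  · rintro _ ⟨x, rfl⟩
    induction x using Finsupp.induction_linear with
    | zero => rw [map_zero]; exact Submodule.zero_mem _
    | add x y hx hy => rw [map_add]; exact Submodule.add_mem _ hx hy
    | single j y =>
      have hcont : Continuous fun y : Ell ψ => ((EllPow.toFinsupp ψ κ).symm.toLinearMap ∘ₗ
          tensorMap ψ f) (Finsupp.single j y) := by
        refine (PiLp.continuousLinearEquiv 2 ℂ fun _ : κ =>
          Ell ψ).toHomeomorph.isInducing.continuous_iff.mpr ?_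
        refine continuous_pi fun i => ?_
        refine (continuous_congr fun y => tensorMap_single_apply ψ f j y i).mpr ?_
        fun_prop
      refine (denseRange_toEll ψ).induction_on y
        ((image ψ (LinearMap.range f)).isClosed_topologicalClosure.preimage hcont) fun a => ?_
      have h : Finsupp.single j (toEll ψ a) = embFinsupp ψ ι (Finsupp.single j a) := by
        simp [embFinsupp]
      refine Submodule.le_topologicalClosure _ ⟨f (Finsupp.single j a), ⟨_, rfl⟩, ?_⟩
      rw [h, LinearMap.comp_apply, tensorMap_embFinsupp]
      rfl
  · rintro _ ⟨_, ⟨x, rfl⟩, rfl⟩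
    refine ⟨embFinsupp ψ ι x, ?_⟩
    rw [LinearMap.comp_apply, tensorMap_embFinsupp]
    rfl

end

/-! ### Independence of the resolution -/

/-- Free modules are projective. -/
lemma exists_lift {ι κ μ : Type u}
    (d : (κ →₀ MonoidAlgebra ℂ G) →ₗ[MonoidAlgebra ℂ G] (μ →₀ MonoidAlgebra ℂ G))
    (f : (ι →₀ MonoidAlgebra ℂ G) →ₗ[MonoidAlgebra ℂ G] (μ →₀ MonoidAlgebra ℂ G))
    (h : ∀ x, f x ∈ LinearMap.range d) :
    ∃ l : (ι →₀ MonoidAlgebra ℂ G) →ₗ[MonoidAlgebra ℂ G] (κ →₀ MonoidAlgebra ℂ G),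
      ∀ x, d (l x) = f x := by
  choose v hv using fun i => h (Finsupp.single i 1)
  refine ⟨Finsupp.linearCombination _ v, fun x => ?_⟩
  induction x using Finsupp.induction_linear with
  | zero => simp
  | add x y hx hy => rw [map_add, map_add, map_add, hx, hy]
  | single i a =>
    rw [Finsupp.linearCombination_single, map_smul, hv, ← map_smul]
    simp

namespace FreeResolution

variable (P Q : FreeResolution G) (ψ : GroupCharacter G)

lemma exists_lift_augmentation :
    ∃ a : (P.ι 0 →₀ MonoidAlgebra ℂ G) →ₗ[MonoidAlgebra ℂ G] (Q.ι 0 →₀ MonoidAlgebra ℂ G),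
      ∀ x, Q.ε (a x) = P.ε x := by
  choose v hv using fun i => Q.ε_surjective (P.ε (Finsupp.single i 1))
  refine ⟨Finsupp.linearCombination _ v, fun x => ?_⟩
  induction x using Finsupp.induction_linear with
  | zero => simp
  | add x y hx hy => rw [map_add, map_add, map_add, hx, hy]
  | single i a =>
    rw [Finsupp.linearCombination_single, map_smulₛₗ, hv, ← map_smulₛₗ]
    simp

variable {P Q} in
lemma exists_lift_one
    {a : (P.ι 0 →₀ MonoidAlgebra ℂ G) →ₗ[MonoidAlgebra ℂ G] (Q.ι 0 →₀ MonoidAlgebra ℂ G)}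
    (ha : ∀ x, Q.ε (a x) = P.ε x) :
    ∃ a₁ : (P.ι 1 →₀ MonoidAlgebra ℂ G) →ₗ[MonoidAlgebra ℂ G] (Q.ι 1 →₀ MonoidAlgebra ℂ G),
      ∀ x, Q.d 0 (a₁ x) = a (P.d 0 x) :=
  exists_lift (Q.d 0) (a ∘ₗ P.d 0) fun x => by
    refine (Q.exact_zero _).mp ?_
    rw [LinearMap.comp_apply, ha]
    exact (P.exact_zero _).mpr ⟨x, rfl⟩

lemma boundaries_orthogonal (k : ℕ) [Fintype (P.ι k)] :
    (P.boundaries ψ k)ᗮ = (image ψ (LinearMap.range (P.d k)))ᗮ := by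
  rw [← Submodule.orthogonal_closure, boundaries, closure_range_tensorMap,
    Submodule.orthogonal_closure]

lemma betti_zero_eq [Fintype (P.ι 0)] :
    P.betti ψ 0 = psiDim ψ (⊤ ⊓ (image ψ (LinearMap.range (P.d 0)))ᗮ) := by
  rw [betti, boundaries_orthogonal]; rfl

lemma betti_one_eq [Fintype (P.ι 0)] [Fintype (P.ι 1)] :
    P.betti ψ 1 = psiDim ψ ((op ψ (P.d 0)).ker ⊓ (image ψ (LinearMap.range (P.d 1)))ᗮ) := by
  rw [betti, boundaries_orthogonal]
  congr 2
  ext x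
  change tensorMap ψ (P.d 0) (EllPow.toFinsupp ψ (P.ι 1) x) = 0 ↔ op ψ (P.d 0) x = 0
  rw [op_apply, LinearEquiv.map_eq_zero_iff]

lemma image_range_le_ker [Fintype (P.ι 0)] [Fintype (P.ι 1)] :
    image ψ (LinearMap.range (P.d 1)) ≤ (op ψ (P.d 0)).ker := by
  rintro _ ⟨x, hx, rfl⟩
  change op ψ (P.d 0) (emb ψ _ x) = 0
  rw [op_emb, (P.exact_succ 0 x).mpr hx, map_zero]

/-- One inequality suffices: exchanging the resolutions gives the other. -/
lemma betti_zero_le [Fintype (P.ι 0)] [Fintype (Q.ι 0)] : P.betti ψ 0 ≤ Q.betti ψ 0 := by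
  obtain ⟨a, ha⟩ := P.exists_lift_augmentation Q
  obtain ⟨b, hb⟩ := Q.exists_lift_augmentation P
  rw [betti_zero_eq, betti_zero_eq]
  refine psiDim_inf_orthogonal_le (fun _ _ _ => trivial) (isInvariant_image ψ _)
    (isInvariant_image ψ _) isClosed_univ le_top isClosed_univ (isEquivariant_op ψ a) (op ψ b)
    (fun _ _ => trivial) ?_ fun x _ => ?_
  · rintro _ ⟨x, hx, rfl⟩
    rw [op_emb]
    refine Submodule.le_topologicalClosure _ ⟨_, (P.exact_zero _).mp ?_, rfl⟩
    rw [hb]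
    exact (Q.exact_zero _).mpr hx
  · have h := op_mem_closure_image ψ (f := b ∘ₗ a - LinearMap.id)
      (M := LinearMap.range (P.d 0)) (fun x => (P.exact_zero _).mp (by
        simp [ha, hb])) x
    rwa [op_sub, op_comp, op_id] at h

lemma betti_one_le [Fintype (P.ι 0)] [Fintype (Q.ι 0)] [Fintype (P.ι 1)] [Fintype (Q.ι 1)] :
    P.betti ψ 1 ≤ Q.betti ψ 1 := by
  obtain ⟨a, ha⟩ := P.exists_lift_augmentation Q
  obtain ⟨b, hb⟩ := Q.exists_lift_augmentation P
  obtain ⟨a₁, ha₁⟩ := exists_lift_one ha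
  obtain ⟨b₁, hb₁⟩ := exists_lift_one hb
  -- Degree-zero part of a chain homotopy from `b ∘ a` to the identity. In degree one, `b₁ a₁ - 1 -
  -- h d₀` lands in `ker d₀ = im d₁`, and the term `h d₀` vanishes on cycles.
  obtain ⟨h, hh⟩ := exists_lift (P.d 0) (b ∘ₗ a - LinearMap.id) fun x =>
    (P.exact_zero _).mp (by simp [ha, hb])
  rw [betti_one_eq, betti_one_eq]
  refine psiDim_inf_orthogonal_le (isEquivariant_op ψ _).isInvariant_ker (isInvariant_image ψ _)
    (isInvariant_image ψ _) (op ψ (P.d 0)).isClosed_ker (Q.image_range_le_ker ψ)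
    (op ψ (Q.d 0)).isClosed_ker (isEquivariant_op ψ a₁) (op ψ b₁) (fun x hx => ?_) ?_
    fun x hx => ?_
  · change op ψ (P.d 0) x = 0 at hx
    change op ψ (Q.d 0) (op ψ a₁ x) = 0
    have e : Q.d 0 ∘ₗ a₁ = a ∘ₗ P.d 0 := LinearMap.ext ha₁
    rw [← op_comp, e, op_comp, hx, map_zero]
  · rintro _ ⟨x, hx, rfl⟩
    rw [op_emb]
    refine Submodule.le_topologicalClosure _ ⟨_, (P.exact_succ 0 _).mp ?_, rfl⟩
    rw [hb₁, (Q.exact_succ 0 x).mpr hx, map_zero]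
  · change op ψ (P.d 0) x = 0 at hx
    have h := op_mem_closure_image ψ (f := b₁ ∘ₗ a₁ - LinearMap.id - h ∘ₗ P.d 0)
      (M := LinearMap.range (P.d 1)) (fun x => (P.exact_succ 0 _).mp (by
        simp [ha₁, hb₁, hh])) x
    rwa [op_sub, op_sub, op_comp, op_comp, op_id, hx, map_zero, sub_zero] at h

end FreeResolution

/-! ### A free resolution from a generating set -/

@[simp]
lemma augmentation_single (g : G) (c : ℂ) : augmentation G (MonoidAlgebra.single g c) = c := by
  change MonoidAlgebra.lift ℂ ℂ G (1 : G →* ℂ) (MonoidAlgebra.single g c) = c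
  simp

/-- A homomorphism of based free `ℂ[G]`-modules. -/
structure FreeHom (G : Type u) [Group G] where
  source : Type u
  target : Type u
  hom : (source →₀ MonoidAlgebra ℂ G) →ₗ[MonoidAlgebra ℂ G] (target →₀ MonoidAlgebra ℂ G)

lemma exact_linearCombination_ker {ι κ : Type u}
    (f : (ι →₀ MonoidAlgebra ℂ G) →ₗ[MonoidAlgebra ℂ G] (κ →₀ MonoidAlgebra ℂ G)) :
    Function.Exact (Finsupp.linearCombination (MonoidAlgebra ℂ G)
      (Subtype.val : LinearMap.ker f → ι →₀ MonoidAlgebra ℂ G)) f := by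
  rw [LinearMap.exact_iff, Finsupp.range_linearCombination, Subtype.range_coe_subtype]
  exact (Submodule.span_eq _).symm

/-- The map onto the kernel of a homomorphism from the free module on that kernel. -/
def FreeHom.next (f : FreeHom G) : FreeHom G where
  source := LinearMap.ker f.hom
  target := f.source
  hom := Finsupp.linearCombination (MonoidAlgebra ℂ G) Subtype.val

lemma FreeHom.exact_next (f : FreeHom G) : Function.Exact f.next.hom f.hom :=
  exact_linearCombination_ker f.hom

/-- The iterates of `FreeHom.next`. -/
def FreeHom.iter (f : FreeHom G) : ℕ → FreeHom G
  | 0 => f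
  | n + 1 => (f.iter n).next

/-- The homomorphism `ℂ[G]^S → ℂ[G]`, `e_s ↦ s - 1`. -/
def generatorMap (S : Finset G) :
    (S →₀ MonoidAlgebra ℂ G) →ₗ[MonoidAlgebra ℂ G] (PUnit.{u + 1} →₀ MonoidAlgebra ℂ G) :=
  Finsupp.linearCombination (MonoidAlgebra ℂ G) fun s : S =>
    Finsupp.single PUnit.unit (MonoidAlgebra.single (s : G) (1 : ℂ) - 1)

/-- `generatorMap` as a homomorphism of based free modules. -/
def generatorHom (S : Finset G) : FreeHom G := ⟨S, PUnit, generatorMap S⟩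

/-- The underlying set `ι n` of a basis in degree `n`. -/
def resolutionIndex (S : Finset G) : ℕ → Type u
  | 0 => PUnit
  | n + 1 => ((generatorHom S).iter n).source

/-- Induction on words, by `gh - 1 = (g - 1) + g(h - 1)` and `g⁻¹ - 1 = -g⁻¹(g - 1)`. -/
lemma generatorMap_exact_aux {S : Finset G} (hS : Subgroup.closure (S : Set G) = ⊤) (g : G) :
    Finsupp.single PUnit.unit (MonoidAlgebra.single g (1 : ℂ) - 1) ∈
      LinearMap.range (generatorMap S) := by
  have hg : g ∈ Subgroup.closure (S : Set G) := hS ▸ Subgroup.mem_top g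
  induction hg using Subgroup.closure_induction with
  | mem s hs => exact ⟨Finsupp.single ⟨s, hs⟩ 1, by simp [generatorMap]⟩
  | one => simp [MonoidAlgebra.one_def]
  | mul g h _ _ hg hh =>
    convert! Submodule.add_mem _ hg
      (Submodule.smul_mem _ (MonoidAlgebra.single g (1 : ℂ)) hh) using 1
    rw [Finsupp.smul_single, ← Finsupp.single_add, smul_eq_mul, mul_sub,
      MonoidAlgebra.single_mul_single, mul_one, mul_one]
    congr 1
    abel
  | inv g _ hg =>
    convert! Submodule.smul_mem _ (-MonoidAlgebra.single g⁻¹ (1 : ℂ)) hg using 1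
    rw [Finsupp.smul_single, smul_eq_mul, mul_sub, neg_mul, MonoidAlgebra.single_mul_single]
    simp [← MonoidAlgebra.one_def, sub_eq_neg_add, add_comm]

/-- The augmentation `ℂ[G]^1 → ℂ`. -/
def unitAugmentation : (PUnit.{u + 1} →₀ MonoidAlgebra ℂ G) →ₛₗ[augmentation G] ℂ where
  toFun x := augmentation G (x PUnit.unit)
  map_add' x y := by simp
  map_smul' a x := by simp

lemma generatorMap_exact {S : Finset G} (hS : Subgroup.closure (S : Set G) = ⊤) :
    Function.Exact (generatorMap S) (unitAugmentation (G := G)) := fun x => by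
  constructor
  · intro hx
    have key : ∀ a : MonoidAlgebra ℂ G,
        Finsupp.single PUnit.unit (a - MonoidAlgebra.single 1 (augmentation G a)) ∈
          LinearMap.range (generatorMap S) := by
      intro a
      induction a using MonoidAlgebra.induction_linear with
      | zero => simp
      | add a b ha hb =>
        convert! Submodule.add_mem _ ha hb using 1
        rw [← Finsupp.single_add, map_add, MonoidAlgebra.single_add]
        congr 1
        abel
      | single g c =>
        convert! Submodule.smul_mem _ (MonoidAlgebra.single 1 c)
          (generatorMap_exact_aux hS g) using 1
        rw [Finsupp.smul_single, smul_eq_mul, mul_sub, MonoidAlgebra.single_mul_single]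
        simp
    have h := key (x PUnit.unit)
    rw [show augmentation G (x PUnit.unit) = 0 from hx, MonoidAlgebra.single_zero, sub_zero] at h
    have e : Finsupp.single PUnit.unit (x PUnit.unit) = x := by ext; simp
    rwa [e] at h
  · rintro ⟨y, rfl⟩
    induction y using Finsupp.induction_linear with
    | zero => simp
    | add x y hx hy => rw [map_add, map_add, hx, hy, add_zero]
    | single s a =>
      simp [generatorMap, unitAugmentation]

/-- The free resolution of `ℂ` that starts with `ℂ[G]^S → ℂ[G]`, `e_s ↦ s - 1`. -/
def generatorResolution (S : Finset G) (hS : Subgroup.closure (S : Set G) = ⊤) :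
    FreeResolution G where
  ι := resolutionIndex S
  d
    -- Each `next` has the previous source as its target, so consecutive maps compose by definition.
    | 0 => (generatorHom S).hom
    | n + 1 => ((generatorHom S).iter (n + 1)).hom
  ε := unitAugmentation
  ε_surjective c := ⟨Finsupp.single PUnit.unit (MonoidAlgebra.single 1 c), by
    change augmentation G (Finsupp.single PUnit.unit (MonoidAlgebra.single 1 c) PUnit.unit) = c
    simp⟩
  exact_zero := generatorMap_exact hS
  exact_succ
    | 0 => (generatorHom S).exact_next
    | n + 1 => ((generatorHom S).iter (n + 1)).exact_next

instance (S : Finset G) (hS : Subgroup.closure (S : Set G) = ⊤) :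
    Fintype ((generatorResolution S hS).ι 0) := inferInstanceAs (Fintype PUnit)

instance (S : Finset G) (hS : Subgroup.closure (S : Set G) = ⊤) :
    Fintype ((generatorResolution S hS).ι 1) := inferInstanceAs (Fintype S)

lemma exists_isPsiBetti (S : Finset G) (hS : Subgroup.closure (S : Set G) = ⊤)
    (ψ : GroupCharacter G) :
    IsPsiBetti ψ 0 ((generatorResolution S hS).betti ψ 0) ∧
      IsPsiBetti ψ 1 ((generatorResolution S hS).betti ψ 1) := by
  have hfin : ∀ i ≤ 1, Finite ((generatorResolution S hS).ι i) := by
    intro i hi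
    interval_cases i <;> infer_instance
  refine ⟨⟨⟨generatorResolution S hS, fun i hi => hfin i (hi.trans zero_le_one)⟩,
    fun P hP _ => ?_⟩, ⟨⟨generatorResolution S hS, hfin⟩, fun P hP _ => ?_⟩⟩
  · exact le_antisymm (P.betti_zero_le _ ψ) (FreeResolution.betti_zero_le _ P ψ)
  · have := hP 0 zero_le_one
    have := Fintype.ofFinite (P.ι 0)
    exact le_antisymm (P.betti_one_le _ ψ) (FreeResolution.betti_one_le _ P ψ)

/-! ### The first Betti number by an Euler characteristic count -/

namespace FreeResolution

variable (P : FreeResolution G) (ψ : GroupCharacter G) [Fintype (P.ι 0)] [Fintype (P.ι 1)]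

lemma betti_one_eq_sub : P.betti ψ 1 = Fintype.card (P.ι 1) - Fintype.card (P.ι 0) +
    P.betti ψ 0 - psiDim ψ (image ψ (LinearMap.ker (P.d 0))) := by
  have h₁ : psiDim ψ (op ψ (P.d 0)).range = psiDim ψ (image ψ (LinearMap.range (P.d 0))) := by
    rw [← psiDim_topologicalClosure (image _ _), ← closure_range_tensorMap,
      psiDim_topologicalClosure]
    congr 1
    ext y
    constructor
    · rintro ⟨x, rfl⟩
      exact ⟨EllPow.toFinsupp ψ _ x, rfl⟩
    · rintro ⟨x, rfl⟩
      refine ⟨(EllPow.toFinsupp ψ _).symm x, ?_⟩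
      change op ψ (P.d 0) _ = _
      rw [op_apply, LinearEquiv.apply_symm_apply]
      rfl
  have h₂ : LinearMap.ker (P.d 0) = LinearMap.range (P.d 1) :=
    LinearMap.exact_iff.mp (P.exact_succ 0)
  rw [betti_one_eq, betti_zero_eq, top_inf_eq, psiDim_orthogonal,
    psiDim_inf_orthogonal (op ψ (P.d 0)).isClosed_ker (P.image_range_le_ker ψ), h₂]
  linarith [psiDim_range (isEquivariant_op ψ (P.d 0))]

end FreeResolution

/-! ### Cycles in the Cayley graph -/

/-- On `V` the functional given by `e` agrees with the one given by its projection `p`.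
Cauchy-Schwarz bounds the quotients by `‖p‖²`, and elements of `V` tending to `p` approach the
bound. -/
lemma sSup_inner_sq_div_norm_sq {E : Type*} [NormedAddCommGroup E] [InnerProductSpace ℂ E]
    (V : Submodule ℂ E) [V.topologicalClosure.HasOrthogonalProjection] (e : E) :
    sSup {r : ℝ | ∃ z ∈ V, z ≠ 0 ∧ r = ‖inner ℂ e z‖ ^ 2 / ‖z‖ ^ 2} =
      ‖V.topologicalClosure.starProjection e‖ ^ 2 := by
  set p := V.topologicalClosure.starProjection e with hp
  have hpV : p ∈ V.topologicalClosure := V.topologicalClosure.starProjection_apply_mem e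
  have hinner : ∀ z ∈ V.topologicalClosure, inner ℂ e z = inner ℂ p z := fun z hz => by
    rw [hp, Submodule.inner_starProjection_left_eq_right,
      Submodule.starProjection_eq_self_iff.mpr hz]
  have hle : ∀ r ∈ {r : ℝ | ∃ z ∈ V, z ≠ 0 ∧ r = ‖inner ℂ e z‖ ^ 2 / ‖z‖ ^ 2}, r ≤ ‖p‖ ^ 2 := by
    rintro _ ⟨z, hz, hz0, rfl⟩
    rw [hinner z (V.le_topologicalClosure hz), div_le_iff₀ (by positivity), ← mul_pow]
    gcongr
    exact norm_inner_le_norm p z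
  refine le_antisymm (Real.sSup_le hle (by positivity)) ?_
  -- For `p = 0` the set may be empty, where `sSup ∅ = 0` is the required value.
  by_cases hp0 : p = 0
  · rw [hp0]
    simp only [_root_.norm_zero, ne_eq, OfNat.ofNat_ne_zero, not_false_eq_true, zero_pow]
    refine Real.sSup_nonneg ?_
    rintro _ ⟨z, _, _, rfl⟩
    positivity
  · have hpV' : p ∈ closure (V : Set E) := hpV
    obtain ⟨z, hzV, hz⟩ := mem_closure_iff_seq_limit.mp hpV'
    have hlim : Filter.Tendsto (fun n => ‖inner ℂ e (z n)‖ ^ 2 / ‖z n‖ ^ 2) Filter.atTop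
        (nhds (‖p‖ ^ 2)) := by
      have h₁ : Filter.Tendsto (fun n => ‖inner ℂ e (z n)‖ ^ 2 / ‖z n‖ ^ 2) Filter.atTop
          (nhds (‖inner ℂ e p‖ ^ 2 / ‖p‖ ^ 2)) :=
        (((tendsto_const_nhds (x := e)).inner (𝕜 := ℂ) hz).norm.pow 2).div (hz.norm.pow 2)
          (by positivity)
      rw [hinner p hpV, inner_self_eq_norm_sq_to_K] at h₁
      convert! h₁ using 2
      have : ‖p‖ ≠ 0 := norm_ne_zero_iff.mpr hp0
      simp
      field_simp
    refine le_of_tendsto hlim ?_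
    filter_upwards [hz.eventually_ne hp0] with n hn
    exact le_csSup ⟨_, hle⟩ ⟨z n, hzV n, hn, rfl⟩

/-! ### Edge chains as the free module `ℂ[G]^S` -/

lemma Edge.dir_mem {S : Finset G} (e : Edge S) : e.1.1⁻¹ * e.1.2 ∈ S := by
  obtain ⟨s, hs, h⟩ := e.2
  rwa [h, inv_mul_cancel_left]

/-- The generator `s` of the edge `(g, g * s)`. -/
def Edge.dir {S : Finset G} (e : Edge S) : S := ⟨e.1.1⁻¹ * e.1.2, e.dir_mem⟩

/-- The linear map `ℂ[E] → ℂ[G]^S` that sends the edge `(g, g * s)` to `g • e_s`. -/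
def edgeMap (S : Finset G) : (Edge S →₀ ℂ) →ₗ[ℂ] (S →₀ MonoidAlgebra ℂ G) :=
  Finsupp.linearCombination ℂ fun e : Edge S =>
    Finsupp.single e.dir (MonoidAlgebra.single e.1.1 (1 : ℂ))

lemma edgeMap_single {S : Finset G} (e : Edge S) (c : ℂ) :
    edgeMap S (Finsupp.single e c) = Finsupp.single e.dir (MonoidAlgebra.single e.1.1 c) := by
  simp [edgeMap]

lemma edgeMap_surjective (S : Finset G) : Function.Surjective (edgeMap S) := by
  rw [← LinearMap.range_eq_top, eq_top_iff]
  rintro x -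
  induction x using Finsupp.induction_linear with
  | zero => exact Submodule.zero_mem _
  | add x y hx hy => exact Submodule.add_mem _ hx hy
  | single s a =>
    induction a using MonoidAlgebra.induction_linear with
    | zero => rw [Finsupp.single_zero]; exact Submodule.zero_mem _
    | add a b ha hb => rw [Finsupp.single_add]; exact Submodule.add_mem _ ha hb
    | single g c =>
      refine ⟨Finsupp.single ⟨(g, g * s), s, s.2, rfl⟩ c, ?_⟩
      rw [edgeMap_single]
      congr 1
      exact Subtype.ext (inv_mul_cancel_left _ _)

/-- On an edge this is `g(s - 1) = gs - g`. -/
lemma generatorMap_edgeMap {S : Finset G} (z : Edge S →₀ ℂ) :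
    generatorMap S (edgeMap S z) = Finsupp.single PUnit.unit (.ofCoeff (boundary S z)) := by
  induction z using Finsupp.induction_linear with
  | zero => simp
  | add x y hx hy =>
    rw [map_add, map_add, map_add, hx, hy, MonoidAlgebra.ofCoeff_add, Finsupp.single_add]
  | single e c =>
    rw [edgeMap_single, generatorMap, Finsupp.linearCombination_single, Finsupp.smul_single,
      smul_eq_mul, mul_sub, MonoidAlgebra.single_mul_single, mul_one, mul_one]
    congr 1
    have h : e.1.1 * (e.dir : G) = e.1.2 := mul_inv_cancel_left _ _
    rw [h, boundary, LinearMap.sub_apply, Finsupp.lmapDomain_apply, Finsupp.lmapDomain_apply,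
      Finsupp.mapDomain_single, Finsupp.mapDomain_single]
    rfl

lemma mem_finiteCycles_iff {S : Finset G} (z : Edge S →₀ ℂ) :
    z ∈ finiteCycles S ↔ edgeMap S z ∈ LinearMap.ker (generatorMap S) := by
  rw [finiteCycles, LinearMap.mem_ker, LinearMap.mem_ker, generatorMap_edgeMap,
    Finsupp.single_eq_zero, MonoidAlgebra.ofCoeff_eq_zero]

variable (ψ : GroupCharacter G)

lemma emb_edgeMap_single {S : Finset G} (e : Edge S) :
    emb ψ S (edgeMap S (Finsupp.single e 1)) = leftPow ψ e.1.1 (EllPow.basis ψ e.dir) := by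
  classical
  ext s
  rw [edgeMap_single, emb_apply, leftPow_apply, EllPow.basis_apply, Finsupp.single_apply]
  by_cases h : e.dir = s
  · rw [if_pos h, if_pos h.symm, toEll_single]
  · rw [if_neg h, if_neg (Ne.symm h), map_zero, map_zero]

lemma inner_leftMul_one (g h : G) :
    inner ℂ (leftMul ψ g (Ell.one ψ)) (leftMul ψ h (Ell.one ψ)) = ψ (g⁻¹ * h) := by
  rw [← toEll_single, ← toEll_single, inner_toEll]
  simp [charForm]

lemma inner_emb_edgeMap {S : Finset G} (z w : Edge S →₀ ℂ) :
    inner ℂ (emb ψ S (edgeMap S w)) (emb ψ S (edgeMap S z)) = edgeInner ψ z w := by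
  classical
  have key : ∀ e f : Edge S, inner ℂ (emb ψ S (edgeMap S (Finsupp.single f 1)))
      (emb ψ S (edgeMap S (Finsupp.single e 1))) =
      if e.1.1⁻¹ * e.1.2 = f.1.1⁻¹ * f.1.2 then ψ (f.1.1⁻¹ * e.1.1) else 0 := by
    intro e f
    rw [emb_edgeMap_single, emb_edgeMap_single, inner_leftPow_basis, leftPow_apply,
      EllPow.basis_apply]
    by_cases h : e.1.1⁻¹ * e.1.2 = f.1.1⁻¹ * f.1.2
    · have h' : e.dir = f.dir := Subtype.ext h
      rw [if_pos h', if_pos h, inner_leftMul_one]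
    · have h' : e.dir ≠ f.dir := fun h' => h (congrArg Subtype.val h')
      rw [if_neg h', if_neg h, map_zero, inner_zero_left]
  have expand : ∀ z : Edge S →₀ ℂ, emb ψ S (edgeMap S z) =
      ∑ e ∈ z.support, z e • emb ψ S (edgeMap S (Finsupp.single e 1)) := by
    intro z
    conv_lhs => rw [← z.sum_single, Finsupp.sum, map_sum, map_sum]
    refine Finset.sum_congr rfl fun e _ => ?_
    rw [← map_smul, ← map_smul, Finsupp.smul_single, smul_eq_mul, mul_one]
  rw [expand z, expand w, inner_sum, edgeInner, Finsupp.sum]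
  refine Finset.sum_congr rfl fun e _ => ?_
  rw [sum_inner, Finsupp.sum]
  refine Finset.sum_congr rfl fun f _ => ?_
  rw [inner_smul_left, inner_smul_right, key, starRingEnd_apply]
  ring

/-- The condition `⟨z, z⟩ ≠ 0` says exactly that `z` has nonzero image in the Hilbert space, so the
supremum over cycles is one over nonzero vectors of the image. -/
lemma cycleSup_eq {S : Finset G} (v : Edge S →₀ ℂ) : cycleSup ψ v =
    ‖(image ψ (LinearMap.ker (generatorMap S))).topologicalClosure.starProjection
      (emb ψ S (edgeMap S v))‖ ^ 2 := by
  rw [← sSup_inner_sq_div_norm_sq, cycleSup]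
  congr 1
  have hzz : ∀ z : Edge S →₀ ℂ, edgeInner ψ z z = ((‖emb ψ S (edgeMap S z)‖ ^ 2 : ℝ) : ℂ) := by
    intro z
    rw [← inner_emb_edgeMap, inner_self_eq_norm_sq_to_K]
    simp
  have hne : ∀ z : Edge S →₀ ℂ, edgeInner ψ z z ≠ 0 ↔ emb ψ S (edgeMap S z) ≠ 0 := by
    intro z
    rw [hzz, Complex.ofReal_ne_zero, pow_ne_zero_iff two_ne_zero, norm_ne_zero_iff]
  ext r
  constructor
  · rintro ⟨z, hz, hz0, rfl⟩
    refine ⟨_, ⟨_, (mem_finiteCycles_iff z).mp hz, rfl⟩, (hne z).mp hz0, ?_⟩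
    rw [hzz, Complex.ofReal_re, inner_emb_edgeMap]
  · rintro ⟨_, ⟨x, hx, rfl⟩, hz0, rfl⟩
    obtain ⟨z, rfl⟩ := edgeMap_surjective S x
    refine ⟨z, (mem_finiteCycles_iff z).mpr hx, (hne z).mpr hz0, ?_⟩
    rw [hzz, Complex.ofReal_re, inner_emb_edgeMap]

lemma leftMul_one (x : Ell ψ) : leftMul ψ 1 x = x := by
  refine (denseRange_toEll ψ).induction_on x (isClosed_eq (by fun_prop) (by fun_prop)) fun a => ?_
  rw [leftMul_toEll, ← MonoidAlgebra.one_def, one_mul]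

/-- The edge `(1, s)` corresponds to the basis vector `e_s`. -/
lemma sum_cycleSup (S : Finset G) :
    ∑ s : S, cycleSup ψ (Finsupp.single (edgeOne s) 1) =
      psiDim ψ (image ψ (LinearMap.ker (generatorMap S))) := by
  rw [psiDim_eq_sum_norm_sq]
  refine Finset.sum_congr rfl fun s _ => ?_
  have h₁ : (edgeOne s).dir = s := Subtype.ext (by simp [Edge.dir, edgeOne])
  have h₂ : emb ψ S (edgeMap S (Finsupp.single (edgeOne s) 1)) = EllPow.basis ψ s := by
    rw [emb_edgeMap_single, h₁]
    ext t
    exact leftMul_one ψ _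
  rw [cycleSup_eq, h₂]

end PsiBetti

end

theorem mainTheorem6 {G : Type*} [Group G] (S : Finset G)
    (hS : Subgroup.closure (S : Set G) = ⊤) (ψ : PsiBetti.GroupCharacter G) :
    ∃ b₀ b₁ : ℝ, PsiBetti.IsPsiBetti ψ 0 b₀ ∧ PsiBetti.IsPsiBetti ψ 1 b₁ ∧
      b₁ = (S.card : ℝ) - 1 + b₀ -
        ∑ s : S, PsiBetti.cycleSup ψ (Finsupp.single (PsiBetti.edgeOne s) 1) := by
  obtain ⟨h₀, h₁⟩ := PsiBetti.exists_isPsiBetti S hS ψ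
  refine ⟨_, _, h₀, h₁, ?_⟩
  rw [PsiBetti.FreeResolution.betti_one_eq_sub, PsiBetti.sum_cycleSup]
  have e₁ : Fintype.card ((PsiBetti.generatorResolution S hS).ι 1) = S.card :=
    Fintype.card_coe S
  have e₀ : Fintype.card ((PsiBetti.generatorResolution S hS).ι 0) = 1 := Fintype.card_punit
  rw [e₀, e₁, Nat.cast_one]
  -- The first differential of the chosen resolution is `generatorMap S` by definition.
  rfl
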